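/- Conventions. A length function on a locally compact (Hausdorff) group $G$ is a function $\ell\colon G\to[0,\infty)$ that is bounded on compact sets and satisfies $\ell(g^{-1})=\ell(g)$ and $\ell(gh)\le \ell(g)+\ell(h)$ for all $g,h\in G$. A lattice in $G$ is a discrete subgroup $\Gamma$ such that $G/\Gamma$ carries a $G$-invariant (regular) Borel probability measure. For a class $\mathcal E$ of complex Banach spaces and a function $w\colon G\to\mathbf R$ bounded above on compact sets, $\mathcal C_{w,\mathcal E}(G)$ denotes the Banach algebra obtained by completing the convolution algebra $C_c(G)$ for the norm $\|f\|=\sup_\pi\|\pi(f)\|$, where $\pi$ runs over all strongly continuous representations of $G$ on a Banach space in $\mathcal E$ such that $\|\pi(g)\|\le e^{w(g)}$ for every $g\in G$, and $\pi(f)x=\int_G f(g)\,\pi(g)x\,dg$ for a left Haar measure $dg$. One writes $\mathcal C_w(G)$ when $\mathcal E$ is the class of Hilbert spaces. A Kazhdan projection in $\mathcal C_{w,\mathcal E}(G)$ is an idempotent $P$ such that, for every such $\pi$, the operator $\pi(P)$ is a projection onto the space of $\pi(G)$-invariant vectors. The same notation is used for $\Gamma$, with the length function $\ell|_\Gamma$.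 The action of $G$ on $G/\Gamma$ has spectral gap if, in the unitary representation of $G$ on $L^2(G/\Gamma)$, the orthogonal complement of the space of invariant vectors does not carry almost invariant vectors. Proposition. Let $\Gamma$ be a lattice in a locally compact group $G$ and let $\ell$ be a length function on $G$. There exists $s_0>0$, depending only on $(G,\Gamma,\ell)$, such that the following hold. (1) For all real $s\le s_0$ and $c\ge 0$, if $\mathcal C_{s\ell+c}(\Gamma)$ has a Kazhdan projection, then so does $\mathcal C_{s\ell+c}(G)$. (2) If the action of $G$ on $G/\Gamma$ has spectral gap, then for every class $\mathcal E$ of Banach spaces and all real $s\le s_0$ and $c\ge 0$, if $\mathcal C_{s\ell+c,\mathcal E}(\Gamma)$ has a Kazhdan projection, then so does $\mathcal C_{s\ell+c,\mathcal E}(G)$. -/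

import Mathlib

open MeasureTheory Set
open scoped ENNReal CompactlySupported

universe u v

noncomputable section

namespace StrongT

/-- A class of complex Banach spaces: a predicate on complex normed spaces. Completeness is imposed
separately, in `BoundedRep`. -/
abbrev BanachClass : Type (v + 1) :=
  ∀ (X : Type v) [NormedAddCommGroup X] [NormedSpace ℂ X], Prop

/-- The class of Hilbert spaces: the norm comes from an inner product. -/
def hilbertClass : BanachClass.{v} := fun X _ i =>
  ∃ I : InnerProductSpace ℂ X, I.toNormedSpace = i

section Weights

variable (G : Type u) [Group G] [TopologicalSpace G]

/-- A length function on a topological group: nonnegative, bounded on compact sets, symmetric and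
subadditive. It need not be continuous, nor measurable. -/
structure LengthFunction where
  toFun : G → ℝ
  nonneg : ∀ g, 0 ≤ toFun g
  bddAbove : ∀ K : Set G, IsCompact K → BddAbove (toFun '' K)
  inv : ∀ g, toFun g⁻¹ = toFun g
  mul_le : ∀ g h, toFun (g * h) ≤ toFun g + toFun h

/-- A real function on `G` bounded above on compact sets. The exponential of such a function is
used as a bound for the norm of representations. -/
structure Weight where
  toFun : G → ℝ
  bddAbove : ∀ K : Set G, IsCompact K → BddAbove (toFun '' K)

variable {G}

/-- The restriction of a length function to a subgroup with the induced topology. -/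
def LengthFunction.restrict (ℓ : LengthFunction G) (Γ : Subgroup G) : LengthFunction Γ where
  toFun γ := ℓ.toFun γ
  nonneg γ := ℓ.nonneg γ
  bddAbove K hK := by
    have h := ℓ.bddAbove _ (hK.image continuous_subtype_val)
    rwa [image_image] at h
  inv γ := ℓ.inv γ
  mul_le γ δ := ℓ.mul_le γ δ

/-- The weight `s ℓ + c`. -/
def LengthFunction.weight (ℓ : LengthFunction G) (s c : ℝ) : Weight G where
  toFun g := s * ℓ.toFun g + c
  bddAbove K hK := by
    obtain ⟨M, hM⟩ := ℓ.bddAbove K hK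
    refine ⟨|s| * M + c, ?_⟩
    rintro _ ⟨g, hg, rfl⟩
    have h1 : ℓ.toFun g ≤ M := hM ⟨g, hg, rfl⟩
    have h2 : s * ℓ.toFun g ≤ |s| * ℓ.toFun g :=
      mul_le_mul_of_nonneg_right (le_abs_self s) (ℓ.nonneg g)
    have h3 : |s| * ℓ.toFun g ≤ |s| * M := mul_le_mul_of_nonneg_left h1 (abs_nonneg s)
    simp only
    linarith

end Weights

/-- A strongly continuous representation `π` of `G` by bounded operators on a Banach space of the
class `E`, with `‖π(g)‖ ≤ exp (w g)` for every `g`. -/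
structure BoundedRep (G : Type u) [Group G] [TopologicalSpace G] (E : BanachClass.{v})
    (w : Weight G) : Type (max u (v + 1)) where
  X : Type v
  [normedAddCommGroup : NormedAddCommGroup X]
  [normedSpace : NormedSpace ℂ X]
  [completeSpace : CompleteSpace X]
  mem : E X
  π : G →* (X →L[ℂ] X)
  strongly_continuous : ∀ x : X, Continuous fun g => π g x
  norm_le : ∀ g, ‖π g‖ ≤ Real.exp (w.toFun g)

attribute [instance] BoundedRep.normedAddCommGroup BoundedRep.normedSpace BoundedRep.completeSpace

section Algebra

variable {G : Type u} [Group G] [TopologicalSpace G]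

/-- The subspace of invariant vectors of a representation. -/
def BoundedRep.invariants {E : BanachClass.{v}} {w : Weight G} (ρ : BoundedRep G E w) :
    Submodule ℂ ρ.X where
  carrier := {x | ∀ g, ρ.π g x = x}
  add_mem' hx hy g := by rw [map_add, hx g, hy g]
  zero_mem' g := map_zero _
  smul_mem' a x hx g := by rw [map_smul, hx g]

/-- A compactly supported function `f` admits a bound, independent of the representation, for the
norm of the operators `π(g)` over the support of `f`. -/
theorem Weight.exists_bound (w : Weight G) (f : C_c(G, ℂ)) :
    ∃ M : ℝ, 0 ≤ M ∧ ∀ (E : BanachClass.{v}) (ρ : BoundedRep G E w) (g : G) (x : ρ.X),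
      ‖f g • ρ.π g x‖ ≤ ‖f g‖ * (M * ‖x‖) := by
  obtain ⟨B, hB⟩ := w.bddAbove _ f.hasCompactSupport
  refine ⟨Real.exp B, (Real.exp_pos B).le, fun E ρ g x => ?_⟩
  rw [norm_smul]
  by_cases hg : f g = 0
  · simp [hg]
  · have hg' : g ∈ tsupport f := subset_tsupport _ hg
    refine mul_le_mul_of_nonneg_left (((ρ.π g).le_opNorm x).trans ?_) (norm_nonneg _)
    exact mul_le_mul_of_nonneg_right
      ((ρ.norm_le g).trans (Real.exp_le_exp.2 (hB ⟨g, hg', rfl⟩))) (norm_nonneg _)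

variable [IsTopologicalGroup G] [LocallyCompactSpace G] [MeasurableSpace G] [BorelSpace G]

theorem BoundedRep.integrable {E : BanachClass.{v}} {w : Weight G} (ρ : BoundedRep G E w)
    (f : C_c(G, ℂ)) (x : ρ.X) :
    Integrable (fun g => f g • ρ.π g x) (Measure.haar : Measure G) :=
  ((map_continuous f).smul (ρ.strongly_continuous x)).integrable_of_hasCompactSupport
    f.hasCompactSupport.smul_right

/-- The norm of `x ↦ ∫ f(g) π(g) x dg` is bounded independently of the representation. -/
theorem Weight.exists_integral_bound (w : Weight G) (f : C_c(G, ℂ)) :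
    ∃ C : ℝ, 0 ≤ C ∧ ∀ (E : BanachClass.{v}) (ρ : BoundedRep G E w) (x : ρ.X),
      ‖∫ g, f g • ρ.π g x ∂(Measure.haar : Measure G)‖ ≤ C * ‖x‖ := by
  obtain ⟨M, hM, h⟩ := w.exists_bound f
  refine ⟨(∫ g, ‖f g‖ ∂(Measure.haar : Measure G)) * M, by positivity, fun E ρ x => ?_⟩
  have hf : Integrable (fun g => ‖f g‖) (Measure.haar : Measure G) :=
    ((map_continuous f).integrable_of_hasCompactSupport f.hasCompactSupport).norm
  calc ‖∫ g, f g • ρ.π g x ∂(Measure.haar : Measure G)‖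
      ≤ ∫ g, ‖f g‖ * (M * ‖x‖) ∂(Measure.haar : Measure G) :=
        norm_integral_le_of_norm_le (hf.mul_const _)
          (Filter.Eventually.of_forall fun g => h E ρ g x)
    _ = _ := by rw [integral_mul_const, mul_assoc]

/-- The operator `π(f) : x ↦ ∫ f(g) π(g) x dg`, where `dg` is a left Haar measure. -/
def BoundedRep.op {E : BanachClass.{v}} {w : Weight G} (ρ : BoundedRep G E w) (f : C_c(G, ℂ)) :
    ρ.X →L[ℂ] ρ.X :=
  LinearMap.mkContinuousOfExistsBound
    { toFun := fun x => ∫ g, f g • ρ.π g x ∂(Measure.haar : Measure G)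
      map_add' := fun x y => by
        simp only [map_add, smul_add]
        exact integral_add (ρ.integrable f x) (ρ.integrable f y)
      map_smul' := fun a x => by
        simp only [map_smul, RingHom.id_apply]
        rw [← integral_smul]
        exact integral_congr_ae (Filter.Eventually.of_forall fun g => smul_comm _ _ _) }
    (by
      obtain ⟨C, -, h⟩ := w.exists_integral_bound f
      exact ⟨C, h E ρ⟩)

theorem BoundedRep.op_apply {E : BanachClass.{v}} {w : Weight G} (ρ : BoundedRep G E w)
    (f : C_c(G, ℂ)) (x : ρ.X) :
    ρ.op f x = ∫ g, f g • ρ.π g x ∂(Measure.haar : Measure G) := rfl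

/-- The convolution `(f * h)(x) = ∫ f(y) h(y⁻¹ x) dy` on `C_c(G)`. -/
def conv (f h : C_c(G, ℂ)) : C_c(G, ℂ) where
  toFun x := ∫ y, f y * h (y⁻¹ * x) ∂(Measure.haar : Measure G)
  continuous_toFun := by
    rw [← continuousOn_univ]
    refine continuousOn_integral_of_compact_support f.hasCompactSupport.isCompact ?_ ?_
    · exact (((map_continuous f).comp continuous_snd).mul ((map_continuous h).comp
        (continuous_snd.inv.mul continuous_fst))).continuousOn
    · intro p y _ hy
      rw [image_eq_zero_of_notMem_tsupport hy, zero_mul]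
  hasCompactSupport' := by
    refine HasCompactSupport.of_support_subset_isCompact
      (f.hasCompactSupport.isCompact.mul h.hasCompactSupport.isCompact) ?_
    intro x hx
    by_contra hx'
    refine hx ?_
    have : ∀ y, f y * h (y⁻¹ * x) = 0 := by
      intro y
      by_contra hy
      refine hx' ⟨y, subset_tsupport _ (left_ne_zero_of_mul hy), y⁻¹ * x,
        subset_tsupport _ (right_ne_zero_of_mul hy), by simp⟩
    simp [this]

/-- `π(f * h) = π(f) π(h)`. -/
theorem BoundedRep.op_conv {E : BanachClass.{v}} {w : Weight G} (ρ : BoundedRep G E w)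
    (f h : C_c(G, ℂ)) : ρ.op (conv f h) = ρ.op f * ρ.op h := by
  ext x
  have key : HasCompactSupport
      (Function.uncurry fun y z : G => (f y * h (y⁻¹ * z)) • ρ.π z x) := by
    refine HasCompactSupport.of_support_subset_isCompact
      (f.hasCompactSupport.isCompact.prod
        (f.hasCompactSupport.isCompact.mul h.hasCompactSupport.isCompact)) ?_
    rintro ⟨y, z⟩ hyz
    have hyz' : f y * h (y⁻¹ * z) ≠ 0 := left_ne_zero_of_smul hyz
    have hy : y ∈ tsupport f := subset_tsupport _ (left_ne_zero_of_mul hyz')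
    exact ⟨hy, y, hy, y⁻¹ * z, subset_tsupport _ (right_ne_zero_of_mul hyz'), by simp⟩
  have hcont : Continuous
      (Function.uncurry fun y z : G => (f y * h (y⁻¹ * z)) • ρ.π z x) :=
    (((map_continuous f).comp continuous_fst).mul ((map_continuous h).comp
      (continuous_fst.inv.mul continuous_snd))).smul
      ((ρ.strongly_continuous x).comp continuous_snd)
  have swap := integral_integral_swap_of_hasCompactSupport hcont key
    (μ := (Measure.haar : Measure G)) (ν := (Measure.haar : Measure G))
  rw [mul_apply_eq_comp, BoundedRep.op_apply, BoundedRep.op_apply]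
  trans ∫ z, ∫ y, (f y * h (y⁻¹ * z)) • ρ.π z x ∂(Measure.haar : Measure G)
      ∂(Measure.haar : Measure G)
  · refine integral_congr_ae (Filter.Eventually.of_forall fun z => ?_)
    exact (integral_smul_const (fun y => f y * h (y⁻¹ * z)) (ρ.π z x)).symm
  rw [← swap]
  refine integral_congr_ae (Filter.Eventually.of_forall fun y => ?_)
  simp only
  rw [BoundedRep.op_apply, ← (ρ.π y).integral_comp_comm (ρ.integrable h x), ← integral_smul,
    ← integral_mul_left_eq_self (fun z => (f y * h (y⁻¹ * z)) • ρ.π z x) y]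
  refine integral_congr_ae (Filter.Eventually.of_forall fun z => ?_)
  simp [mul_smul]

variable (E : BanachClass.{v}) (w : Weight G)

/-- The Banach algebra of bounded families of operators `(T_ρ)`, indexed by all representations in
`E` bounded by `exp w`, with pointwise operations and the norm `sup_ρ ‖T_ρ‖`. -/
abbrev Families : Type (max u (v + 1)) :=
  lp (fun ρ : BoundedRep G E w => (ρ.X →L[ℂ] ρ.X)) ∞

/-- The linear map `f ↦ (π(f))_π` on `C_c(G)`. -/
def toFamilies : C_c(G, ℂ) →ₗ[ℂ] Families E w where
  toFun f := ⟨fun ρ => ρ.op f, memℓp_infty (by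
    obtain ⟨C, hC, h⟩ := w.exists_integral_bound f
    refine ⟨C, ?_⟩
    rintro _ ⟨ρ, rfl⟩
    exact ContinuousLinearMap.opNorm_le_bound _ hC (h E ρ))⟩
  map_add' f h := by
    ext ρ x
    change ρ.op (f + h) x = ρ.op f x + ρ.op h x
    simp only [BoundedRep.op_apply, CompactlySupportedContinuousMap.add_apply, add_smul]
    exact integral_add (ρ.integrable f x) (ρ.integrable h x)
  map_smul' a f := by
    ext ρ x
    change ρ.op (a • f) x = a • ρ.op f x
    simp only [BoundedRep.op_apply, CompactlySupportedContinuousMap.smul_apply, smul_assoc]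
    exact integral_smul _ _

/-- The norm induced on `C_c(G)` is `‖f‖ = sup_π ‖π(f)‖`. -/
theorem norm_toFamilies (f : C_c(G, ℂ)) :
    ‖toFamilies E w f‖ = ⨆ ρ : BoundedRep G E w, ‖ρ.op f‖ :=
  lp.norm_eq_ciSup _

/-- The map `f ↦ (π(f))_π` turns convolution into multiplication. -/
theorem toFamilies_conv (f h : C_c(G, ℂ)) :
    toFamilies E w (conv f h) = toFamilies E w f * toFamilies E w h := by
  ext1
  funext ρ
  exact ρ.op_conv f h

/-- The image of the convolution algebra `C_c(G)`. -/
def convImage : NonUnitalSubalgebra ℂ (Families E w) where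
  __ := LinearMap.range (toFamilies E w)
  mul_mem' := by
    rintro _ _ ⟨f, rfl⟩ ⟨h, rfl⟩
    exact ⟨conv f h, toFamilies_conv E w f h⟩

/-- The Banach algebra `𝒞_{w,E}(G)`: the completion of the convolution algebra `C_c(G)` for the
norm `‖f‖ = sup_π ‖π(f)‖`, over all strongly continuous representations `π` of `G` on a space in
`E` with `‖π(g)‖ ≤ exp (w g)`. It is realized as the closure of the image of `C_c(G)` in the
Banach algebra `Families E w`, to which `C_c(G)` maps with exactly this norm. -/
def groupAlgebra : NonUnitalSubalgebra ℂ (Families E w) :=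
  @NonUnitalSubalgebra.topologicalClosure ℂ (Families E w) _ _ _ _ _ _ (convImage E w)

variable {E w} in
/-- The operator `π(a)`, for `a` in `𝒞_{w,E}(G)`: the continuous extension of `f ↦ π(f)`. -/
def BoundedRep.ext (ρ : BoundedRep G E w) (a : groupAlgebra E w) : ρ.X →L[ℂ] ρ.X :=
  (a : Families E w) ρ

/-- `𝒞_{w,E}(G)` has a Kazhdan projection: an idempotent `P` such that `π(P)` is a projection onto
the space of invariant vectors, for every representation `π` entering the definition of the
algebra. -/
def HasKazhdanProjection : Prop :=
  ∃ P : groupAlgebra E w, IsIdempotentElem P ∧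
    ∀ ρ : BoundedRep G E w, LinearMap.IsProj ρ.invariants (ρ.ext P)

end Algebra

section SpectralGap

variable (G : Type u) [Group G] {Y : Type v} [MulAction G Y] [MeasurableSpace Y]
  [MeasurableConstSMul G Y] (ν : Measure Y) [SMulInvariantMeasure G Y ν]

variable {G} in
/-- The Koopman representation `(λ(g) f)(y) = f(g⁻¹ y)` of `G` on `L²(Y, ν)`. -/
def koopman (g : G) : Lp ℂ 2 ν →ₗᵢ[ℂ] Lp ℂ 2 ν :=
  Lp.compMeasurePreservingₗᵢ ℂ (fun y => g⁻¹ • y) (measurePreserving_smul g⁻¹ ν)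

/-- The action of `G` on `(Y, ν)` has spectral gap: the orthogonal of the space of invariant
vectors of the Koopman representation does not carry almost invariant vectors, that is, there are
a compact set `Q` and `ε > 0` such that every `f` in this orthogonal is moved by at least `ε ‖f‖`
by some element of `Q`. -/
def HasSpectralGap [TopologicalSpace G] : Prop :=
  ∃ (Q : Set G) (ε : ℝ), IsCompact Q ∧ 0 < ε ∧
    ∀ f : Lp ℂ 2 ν, (∀ h : Lp ℂ 2 ν, (∀ g : G, koopman ν g h = h) → inner ℂ h f = 0) →
      ∃ g ∈ Q, ε * ‖f‖ ≤ ‖koopman ν g f - f‖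

end SpectralGap

end StrongT

end

/-!
Kazhdan projections pass from a lattice `Γ` to the ambient group `G` by averaging over `G/Γ`. Let
`P` be a Kazhdan projection for `Γ` and `π` a representation of `G`. For every vector `x` the vector
`η = π(P) x` is `Γ`-invariant, so `π(g) η` depends on `gΓ` only, and `∫ π(g) η dν(gΓ)` is
`G`-invariant. The points are that the integral converges, and that it is the action of an element
of the Banach algebra of `G`.

*Convergence.* Assume that `G/Γ` has spectral gap, and choose a compact neighbourhood `K` of the
identity containing a compact set that witnesses the gap. The spectral gap inequality, applied to
the indicator function of the complement of the image of `Kⁿ⁺¹`, shows that the measure of these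
complements decays exponentially (`HasSpectralGap.exists_exponential_decay`). As a length function
grows at most linearly along the powers of `K`, this decay offsets the growth of `exp (s₀ ℓ)` when
`s₀` is small. The spectral gap is a statement about the orthogonal of the invariant vectors, so
this uses that these are the constants, that is, that `G` acts ergodically on `G/Γ`
(`ergodicSMul_quotient`).

*Membership.* By Weil's formula (`exists_integral_orbitSum_eq`), averaging `η` with a compactly
supported density on `G/Γ` is the action of a function `f ∈ C_c(G)`, the same for all
representations. With cut-off functions `f_n` for the images of `Kⁿ`, the products `f_n P` belong to
the algebra of `G` (`toFamilies_mul_restrictFamilies_mem`), form a Cauchy sequence for the norm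
of this algebra, and converge to a Kazhdan projection
(`hasKazhdanProjection_of_exponential_decay`).

For Hilbert spaces the spectral gap need not be assumed. If the weight is nonnegative on `Γ`,
the Koopman representation on `L²(G/Γ)` is admissible for `Γ`, and a Kazhdan projection for `Γ`
forces spectral gap (`hasSpectralGap_of_hasKazhdanProjection`). If the weight is negative
somewhere on `Γ`, all representations of `G` under consideration are zero
(`hasKazhdanProjection_of_neg`).
-/

noncomputable section

namespace StrongT

open Filter Topology
open scoped Pointwise NNReal

/-! ### Summation over orbits and Weil's formula -/

/-- Compact subsets of `G/Γ` are covered by the images of compact subsets of `G`. -/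
theorem exists_isCompact_subset_image_mk {G : Type u} [Group G] [TopologicalSpace G]
    [IsTopologicalGroup G] [LocallyCompactSpace G] (Γ : Subgroup G) {L : Set (G ⧸ Γ)}
    (hL : IsCompact L) :
    ∃ K : Set G, IsCompact K ∧ L ⊆ ((↑) : G → G ⧸ Γ) '' K := by
  refine hL.induction_on (p := fun L => ∃ K : Set G, IsCompact K ∧ L ⊆ ((↑) : G → G ⧸ Γ) '' K)
    ⟨∅, isCompact_empty, by simp⟩ ?_ ?_ ?_
  · rintro s t hst ⟨K, hK, h⟩
    exact ⟨K, hK, hst.trans h⟩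
  · rintro s t ⟨K, hK, h⟩ ⟨K', hK', h'⟩
    exact ⟨K ∪ K', hK.union hK', by rw [image_union]; exact union_subset_union h h'⟩
  · intro x _
    obtain ⟨g, rfl⟩ := QuotientGroup.mk_surjective x
    obtain ⟨K, hK, hgK⟩ := exists_compact_mem_nhds g
    exact ⟨_, mem_nhdsWithin_of_mem_nhds (QuotientGroup.isOpenMap_coe.image_mem_nhds hgK),
      K, hK, Subset.rfl⟩

/-- The function `gΓ ↦ ∑_γ f(gγ)`. -/
def orbitSumFun {G : Type u} [Group G] (Γ : Subgroup G) (f : G → ℝ) : G ⧸ Γ → ℝ :=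
  Quotient.lift (fun g : G => ∑ᶠ γ : Γ, f (g * γ)) (by
    intro a b hab
    have h : a⁻¹ * b ∈ Γ := QuotientGroup.leftRel_apply.1 hab
    refine (finsum_eq_of_bijective (fun γ : Γ => (⟨a⁻¹ * b, h⟩ : Γ) * γ)
      (Group.mulLeft_bijective _) fun γ => ?_).symm
    simp [← mul_assoc])

theorem orbitSumFun_mk {G : Type u} [Group G] (Γ : Subgroup G) (f : G → ℝ) (g : G) :
    orbitSumFun Γ f (g : G ⧸ Γ) = ∑ᶠ γ : Γ, f (g * γ) := rfl

section OrbitSum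

variable {G : Type u} [Group G] [TopologicalSpace G] [IsTopologicalGroup G] [T2Space G]
  (Γ : Subgroup G) [DiscreteTopology Γ]

theorem finite_setOf_exists_mul_ne_zero {f : G → ℝ} (hf : HasCompactSupport f) {K : Set G}
    (hK : IsCompact K) : {γ : Γ | ∃ g ∈ K, f (g * γ) ≠ 0}.Finite := by
  have h := Γ.tendsto_coe_cofinite_of_discrete (isDiscrete_iff_discreteTopology.2 inferInstance)
  have hc : IsCompact (K⁻¹ * tsupport f) := hK.inv.mul hf.isCompact
  have h2 : {γ : Γ | (γ : G) ∈ K⁻¹ * tsupport f}.Finite := by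
    have := h hc.compl_mem_cocompact
    rwa [Filter.mem_map, mem_cofinite, preimage_compl, compl_compl] at this
  refine h2.subset ?_
  rintro γ ⟨g, hg, hne⟩
  exact ⟨g⁻¹, inv_mem_inv.2 hg, g * γ, subset_tsupport _ hne, by simp⟩

theorem finite_support_mul_right {f : G → ℝ} (hf : HasCompactSupport f) (g : G) :
    (Function.support fun γ : Γ => f (g * γ)).Finite :=
  (finite_setOf_exists_mul_ne_zero Γ hf (isCompact_singleton (x := g))).subset
    fun _ hγ => ⟨g, rfl, hγ⟩

theorem continuous_orbitSumFun [LocallyCompactSpace G] {f : G → ℝ} (hf : Continuous f)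
    (hf' : HasCompactSupport f) : Continuous (orbitSumFun Γ f) := by
  refine (QuotientGroup.isQuotientMap_mk Γ).continuous_iff.2 ?_
  refine continuous_finsum (f := fun (γ : Γ) g => f (g * γ))
    (fun γ => hf.comp (continuous_mul_const _)) fun g => ?_
  obtain ⟨K, hK, hgK⟩ := exists_compact_mem_nhds g
  refine ⟨K, hgK, (finite_setOf_exists_mul_ne_zero Γ hf' hK).subset ?_⟩
  rintro γ ⟨x, hx, hxK⟩
  exact ⟨x, hxK, hx⟩

theorem hasCompactSupport_orbitSumFun {f : G → ℝ} (hf' : HasCompactSupport f) :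
    HasCompactSupport (orbitSumFun Γ f) := by
  refine HasCompactSupport.of_support_subset_isCompact
    (hf'.isCompact.image (QuotientGroup.continuous_mk (N := Γ))) ?_
  intro x hx
  obtain ⟨g, rfl⟩ := QuotientGroup.mk_surjective x
  rw [Function.mem_support, orbitSumFun_mk] at hx
  obtain ⟨γ, hγ⟩ : ∃ γ : Γ, f (g * γ) ≠ 0 := by
    by_contra! h
    exact hx (finsum_eq_zero_of_forall_eq_zero h)
  exact ⟨g * γ, subset_tsupport _ hγ, QuotientGroup.mk_mul_of_mem g γ.2⟩

variable [LocallyCompactSpace G]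

/-- Summation over the orbits of `Γ`, as a linear map `C_c(G) → C_c(G/Γ)`. -/
def orbitSum : C_c(G, ℝ) →ₗ[ℝ] C_c(G ⧸ Γ, ℝ) where
  toFun f :=
    { toFun := orbitSumFun Γ f
      continuous_toFun := continuous_orbitSumFun Γ (map_continuous f) f.hasCompactSupport
      hasCompactSupport' := hasCompactSupport_orbitSumFun Γ f.hasCompactSupport }
  map_add' f h := by
    ext x
    obtain ⟨g, rfl⟩ := QuotientGroup.mk_surjective x
    exact finsum_add_distrib (finite_support_mul_right Γ f.hasCompactSupport g)
      (finite_support_mul_right Γ h.hasCompactSupport g)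
  map_smul' a f := by
    ext x
    obtain ⟨g, rfl⟩ := QuotientGroup.mk_surjective x
    exact (smul_finsum' a (finite_support_mul_right Γ f.hasCompactSupport g)).symm

theorem orbitSum_mk (f : C_c(G, ℝ)) (g : G) :
    orbitSum Γ f (g : G ⧸ Γ) = ∑ᶠ γ : Γ, f (g * γ) := rfl

theorem orbitSum_nonneg {f : C_c(G, ℝ)} (hf : ∀ g, 0 ≤ f g) (x : G ⧸ Γ) : 0 ≤ orbitSum Γ f x := by
  obtain ⟨g, rfl⟩ := QuotientGroup.mk_surjective x
  exact finsum_nonneg fun γ => hf _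

theorem orbitSum_pos {f : C_c(G, ℝ)} (hf : ∀ g, 0 ≤ f g) {g : G} (hg : 0 < f g) :
    0 < orbitSum Γ f (g : G ⧸ Γ) :=
  finsum_pos (fun γ => hf _) ⟨1, by simpa using hg⟩
    (finite_support_mul_right Γ f.hasCompactSupport g)

/-- The product of a function on `G` with a right `Γ`-invariant function. -/
def mulQuotient (f : C_c(G, ℝ)) {k : G ⧸ Γ → ℝ} (hk : Continuous k) : C_c(G, ℝ) where
  toFun g := f g * k (g : G ⧸ Γ)
  continuous_toFun := (map_continuous f).mul (hk.comp QuotientGroup.continuous_mk)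
  hasCompactSupport' := f.hasCompactSupport.mul_right

theorem orbitSum_mulQuotient (f : C_c(G, ℝ)) {k : G ⧸ Γ → ℝ} (hk : Continuous k) (x : G ⧸ Γ) :
    orbitSum Γ (mulQuotient Γ f hk) x = orbitSum Γ f x * k x := by
  obtain ⟨g, rfl⟩ := QuotientGroup.mk_surjective x
  rw [orbitSum_mk, orbitSum_mk, finsum_mul' _ _ (finite_support_mul_right Γ f.hasCompactSupport g)]
  refine finsum_congr fun γ => ?_
  change f (g * γ) * k ((g * γ : G) : G ⧸ Γ) = _
  rw [QuotientGroup.mk_mul_of_mem g γ.2]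

theorem orbitSum_surjective : Function.Surjective (orbitSum Γ) := by
  intro k
  obtain ⟨K, hK, hkK⟩ := exists_isCompact_subset_image_mk Γ k.hasCompactSupport.isCompact
  obtain ⟨φ, hφ1, -, hφc, hφ⟩ := exists_continuous_one_zero_of_isCompact hK isClosed_empty
    (disjoint_empty K)
  -- the lift is `φ · k / ∑_γ φ(·γ)`, where `φ = 1` on a compact set covering the support of `k`
  let Φ : C_c(G, ℝ) := ⟨φ, hφc⟩
  have hΦ : ∀ g, 0 ≤ Φ g := fun g => (hφ g).1
  have hpos : ∀ x ∈ tsupport k, 0 < orbitSum Γ Φ x := by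
    intro x hx
    obtain ⟨g, hg, rfl⟩ := hkK hx
    exact orbitSum_pos Γ hΦ (by change 0 < φ g; rw [hφ1 hg]; exact one_pos)
  have hcont : Continuous fun x => k x / orbitSum Γ Φ x := by
    refine continuous_of_tsupport fun x hx => ?_
    have hx' : x ∈ tsupport k := by
      refine closure_mono ?_ hx
      intro y hy h
      exact hy (by simp only [h, zero_div])
    exact (map_continuous k).continuousAt.div (map_continuous _).continuousAt (hpos x hx').ne'
  refine ⟨mulQuotient Γ Φ hcont, ?_⟩
  ext x
  rw [orbitSum_mulQuotient]
  by_cases hx : x ∈ tsupport k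
  · exact mul_div_cancel₀ _ (hpos x hx).ne'
  · simp [image_eq_zero_of_notMem_tsupport hx]

/-- The translate `y ↦ f(h y)` of a function on a space on which `G` acts. -/
def translate {Y : Type*} [TopologicalSpace Y] [MulAction G Y] [ContinuousConstSMul G Y] (h : G)
    (f : C_c(Y, ℝ)) : C_c(Y, ℝ) where
  toFun y := f (h • y)
  continuous_toFun := (map_continuous f).comp (continuous_const_smul h)
  hasCompactSupport' := f.hasCompactSupport.comp_homeomorph (Homeomorph.smul h)

theorem orbitSum_translate (h : G) (f : C_c(G, ℝ)) :
    orbitSum Γ (translate h f) = translate h (orbitSum Γ f) := by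
  ext x
  obtain ⟨g, rfl⟩ := QuotientGroup.mk_surjective x
  change ∑ᶠ γ : Γ, f (h * (g * γ)) = ∑ᶠ γ : Γ, f (h * g * γ)
  simp only [mul_assoc]

section Weil

variable [MeasurableSpace G] [BorelSpace G] [MeasurableSpace (G ⧸ Γ)] [BorelSpace (G ⧸ Γ)]
  (ν : Measure (G ⧸ Γ)) [SMulInvariantMeasure G (G ⧸ Γ) ν]

/-- Weil's integration formula. The functional `f ↦ ∫ ∑_γ f(xγ) dν(x)` is positive and left
invariant, hence a multiple of the Haar integral. -/
theorem exists_integral_orbitSum_eq [IsFiniteMeasureOnCompacts ν] :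
    ∃ κ : ℝ≥0, ∀ f : C_c(G, ℝ),
      ∫ x, orbitSum Γ f x ∂ν = κ * ∫ g, f g ∂(Measure.haar : Measure G) := by
  let Λ : C_c(G, ℝ) →ₚ[ℝ] ℝ := PositiveLinearMap.mk₀
    ((CompactlySupportedContinuousMap.integralPositiveLinearMap ν).toLinearMap ∘ₗ orbitSum Γ)
    fun f hf => integral_nonneg (orbitSum_nonneg Γ hf)
  have hΛ : ∀ f, Λ f = ∫ x, orbitSum Γ f x ∂ν := fun f => rfl
  let μ := RealRMK.rieszMeasure Λ
  have hμ : ∀ f : C_c(G, ℝ), ∫ g, f g ∂μ = ∫ x, orbitSum Γ f x ∂ν := fun f =>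
    (RealRMK.integral_rieszMeasure Λ f).trans (hΛ f)
  have : μ.IsMulLeftInvariant := by
    refine ⟨fun h => ?_⟩
    have : (μ.map (h * ·)).Regular := Measure.Regular.map (Homeomorph.mulLeft h)
    refine Measure.ext_of_integral_eq_on_compactlySupported fun f => ?_
    rw [(measurableEmbedding_mulLeft h).integral_map]
    calc ∫ g, f (h * g) ∂μ = ∫ x, orbitSum Γ (translate h f) x ∂ν := hμ (translate h f)
      _ = ∫ x, orbitSum Γ f (h • x) ∂ν := by rw [orbitSum_translate]; rfl
      _ = ∫ x, orbitSum Γ f x ∂ν := integral_smul_eq_self _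
      _ = ∫ g, f g ∂μ := (hμ f).symm
  refine ⟨Measure.haarScalarFactor μ Measure.haar, fun f => ?_⟩
  rw [← hμ, Measure.integral_isMulLeftInvariant_eq_smul_of_hasCompactSupport μ Measure.haar
    (map_continuous f) f.hasCompactSupport, integral_smul_nnreal_measure]
  rfl

end Weil

end OrbitSum

/-! ### Uniqueness of the invariant measure and ergodicity -/

section Ergodic

variable {G : Type u} [Group G] [TopologicalSpace G] [IsTopologicalGroup G] [T2Space G]
  [LocallyCompactSpace G] [MeasurableSpace G] [BorelSpace G]
  (Γ : Subgroup G) [DiscreteTopology Γ] [MeasurableSpace (G ⧸ Γ)] [BorelSpace (G ⧸ Γ)]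

/-- Invariant measures on `G/Γ` are unique up to a scalar: by Weil's formula they agree, up to a
scalar, on the functions `∑_γ f(xγ)`, which are all the compactly supported continuous ones. -/
theorem exists_eq_smul_of_smulInvariant (ν ν' : Measure (G ⧸ Γ)) [ν.Regular] [ν'.Regular]
    [SMulInvariantMeasure G (G ⧸ Γ) ν] [SMulInvariantMeasure G (G ⧸ Γ) ν'] (hν : ν ≠ 0) :
    ∃ c : ℝ≥0, ν' = c • ν := by
  obtain ⟨κ, hκ⟩ := exists_integral_orbitSum_eq Γ ν
  obtain ⟨κ', hκ'⟩ := exists_integral_orbitSum_eq Γ ν'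
  have hκ0 : κ ≠ 0 := by
    rintro rfl
    refine hν (Measure.ext_of_integral_eq_on_compactlySupported fun k => ?_)
    obtain ⟨f, rfl⟩ := orbitSum_surjective Γ k
    rw [hκ]
    simp
  have hκ0' : (κ : ℝ) ≠ 0 := by exact_mod_cast hκ0
  refine ⟨κ' / κ, Measure.ext_of_integral_eq_on_compactlySupported fun k => ?_⟩
  obtain ⟨f, rfl⟩ := orbitSum_surjective Γ k
  rw [integral_smul_nnreal_measure, hκ, hκ', NNReal.smul_def, smul_eq_mul, NNReal.coe_div]
  field_simp

variable (ν : Measure (G ⧸ Γ)) [IsFiniteMeasure ν] [ν.Regular]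
  [SMulInvariantMeasure G (G ⧸ Γ) ν]

/-- The action of `G` on `G/Γ` is ergodic. As `G` need not be σ-compact, Fubini's theorem
does not replace an almost invariant set by an invariant one; instead, the restriction of `ν` to such a set is an
invariant measure, hence a multiple of `ν`. -/
theorem ergodicSMul_quotient : ErgodicSMul G (G ⧸ Γ) ν := by
  refine ⟨fun {s} hs h => ?_⟩
  by_cases hν : ν = 0
  · exact eventuallyConst_set.2 (Or.inl (by simp [hν]))
  have hreg : (ν.restrict s).Regular :=
    Measure.Regular.restrict_of_measure_ne_top (measure_ne_top _ _)
  have hinv : SMulInvariantMeasure G (G ⧸ Γ) (ν.restrict s) := by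
    refine ⟨fun g t ht => ?_⟩
    rw [Measure.restrict_apply ht, Measure.restrict_apply (measurable_const_smul g ht)]
    rw [← measure_preimage_smul ν g (t ∩ s), preimage_inter]
    exact measure_congr (EventuallyEq.rfl.inter (h g).symm)
  obtain ⟨c, hc⟩ := exists_eq_smul_of_smulInvariant Γ ν (ν.restrict s) hν
  have h0 : c • ν sᶜ = 0 := by
    have : (ν.restrict s) sᶜ = 0 := by simp [Measure.restrict_apply hs.compl]
    rw [hc] at this
    simpa using this
  rw [eventuallyConst_set]
  rcases smul_eq_zero.1 h0 with rfl | h0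
  · right
    have : (ν.restrict s) s = 0 := by rw [hc]; simp
    rw [Measure.restrict_apply_self] at this
    exact measure_eq_zero_iff_ae_notMem.1 this
  · left
    exact mem_ae_iff.2 h0

/-- The vector valued form of Weil's integration formula. -/
theorem integral_orbitSum_smul {X : Type v} [NormedAddCommGroup X] [NormedSpace ℝ X]
    [CompleteSpace X] {ν : Measure (G ⧸ Γ)} [IsFiniteMeasureOnCompacts ν] {κ : ℝ≥0}
    (hκ : ∀ f : C_c(G, ℝ), ∫ x, orbitSum Γ f x ∂ν = κ * ∫ g, f g ∂(Measure.haar : Measure G))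
    (f : C_c(G, ℝ)) {φ : G ⧸ Γ → X} (hφ : Continuous φ) :
    ∫ x, orbitSum Γ f x • φ x ∂ν =
      (κ : ℝ) • ∫ g, f g • φ (g : G ⧸ Γ) ∂(Measure.haar : Measure G) := by
  refine (SeparatingDual.eq_iff_forall_dual_eq (R := ℝ)).2 fun L => ?_
  have h1 : Integrable (fun x => orbitSum Γ f x • φ x) ν :=
    ((map_continuous _).smul hφ).integrable_of_hasCompactSupport
      (orbitSum Γ f).hasCompactSupport.smul_right
  have h2 : Integrable (fun g : G => f g • φ (g : G ⧸ Γ)) (Measure.haar : Measure G) :=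
    ((map_continuous _).smul (hφ.comp QuotientGroup.continuous_mk)).integrable_of_hasCompactSupport
      f.hasCompactSupport.smul_right
  rw [map_smul, ← L.integral_comp_comm h1, ← L.integral_comp_comm h2]
  have := hκ (mulQuotient Γ f (L.continuous.comp hφ))
  simp only [orbitSum_mulQuotient] at this
  simpa [mulQuotient] using this

end Ergodic

/-! ### Spectral gap and exponential decay of the measure -/

section GapOfSets

variable {G : Type u} [Group G] {Y : Type v} [MulAction G Y] [MeasurableSpace Y]
  [MeasurableConstSMul G Y] {ν : Measure Y} [IsProbabilityMeasure ν]

theorem koopman_indicatorConstLp [SMulInvariantMeasure G Y ν] (g : G) {A : Set Y}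
    (hA : MeasurableSet A) (b : ℂ) :
    koopman ν g (indicatorConstLp 2 hA (measure_ne_top ν A) b) =
      indicatorConstLp 2 (hA.preimage (measurable_const_smul g⁻¹)) (measure_ne_top ν _) b := rfl

/-- A vector of `L²` which is invariant under an ergodic action is constant. -/
theorem exists_eq_smul_of_koopman_invariant [ErgodicSMul G Y ν] {h : Lp ℂ 2 ν}
    (hh : ∀ g : G, koopman ν g h = h) :
    ∃ c : ℂ, h = indicatorConstLp 2 MeasurableSet.univ (measure_ne_top ν _) c := by
  have hinv : ∀ g : G, (fun y => h (g • y)) =ᵐ[ν] h := fun g => by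
    have h1 : koopman ν g⁻¹ h =ᵐ[ν] fun y => h (g⁻¹⁻¹ • y) :=
      Lp.coeFn_compMeasurePreserving _ (measurePreserving_smul g⁻¹⁻¹ ν)
    rw [hh, inv_inv] at h1
    exact h1.symm
  obtain ⟨c, hc⟩ : ∃ c, h =ᵐ[ν] Function.const Y c := by
    refine exists_eventuallyEq_const_of_forall_separating MeasurableSet fun U hU => ?_
    refine eventuallyConst_set.1 (aeconst_of_forall_preimage_smul_ae_eq G (s := h ⁻¹' U)
      ((Lp.stronglyMeasurable h).measurable hU).nullMeasurableSet fun g => ?_)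
    refine ((hinv g).mono fun x hx => ?_).set_eq
    simp only [mem_preimage] at hx ⊢
    rw [hx]
  refine ⟨c, Lp.ext (hc.trans ?_)⟩
  filter_upwards [indicatorConstLp_coeFn (p := 2) (hs := MeasurableSet.univ)
    (hμs := measure_ne_top ν univ) (c := c)] with y hy
  rw [hy]
  simp

/-- The spectral gap inequality applied to the projection of the indicator function of `A` to the
orthogonal of the constants. -/
theorem exists_mem_sq_mul_measureReal_le [ErgodicSMul G Y ν] {Q : Set G} {ε : ℝ} (hε : 0 < ε)
    (hgap : ∀ f : Lp ℂ 2 ν, (∀ h : Lp ℂ 2 ν, (∀ g : G, koopman ν g h = h) → inner ℂ h f = 0) →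
      ∃ g ∈ Q, ε * ‖f‖ ≤ ‖koopman ν g f - f‖) {A : Set Y} (hA : MeasurableSet A) :
    ∃ g ∈ Q, ε ^ 2 * (ν.real A * (1 - ν.real A)) ≤
      2 * (ν.real A - ν.real ((fun y => g⁻¹ • y) ⁻¹' A ∩ A)) := by
  set one : Lp ℂ 2 ν := indicatorConstLp 2 MeasurableSet.univ (measure_ne_top ν _) 1 with hone
  set χ : Lp ℂ 2 ν := indicatorConstLp 2 hA (measure_ne_top ν A) 1 with hχ
  have hnorm : ∀ {B : Set Y} (hB : MeasurableSet B),
      ‖(indicatorConstLp 2 hB (measure_ne_top ν B) 1 : Lp ℂ 2 ν)‖ ^ 2 = ν.real B := by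
    intro B hB
    have h1 := L2.inner_indicatorConstLp_one_indicatorConstLp_one (𝕜 := ℂ) (μ := ν) hB hB
    rw [inter_self, inner_self_eq_norm_sq_to_K] at h1
    exact_mod_cast h1
  have h1χ : inner ℂ one χ = (ν.real A : ℂ) := by
    rw [hone, hχ, L2.inner_indicatorConstLp_one_indicatorConstLp_one, univ_inter]
    rfl
  have h11 : inner ℂ one one = (1 : ℂ) := by
    rw [hone, L2.inner_indicatorConstLp_one_indicatorConstLp_one]
    simp
  have hone1 : ‖one‖ ^ 2 = 1 := by rw [hnorm]; simp
  set a := ν.real A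
  have hf0 : inner ℂ one (χ - (a : ℂ) • one) = 0 := by
    rw [inner_sub_right, inner_smul_right, h1χ, h11, mul_one, sub_self]
  obtain ⟨g, hg, hle⟩ := hgap (χ - (a : ℂ) • one) fun h hh => by
    obtain ⟨c, rfl⟩ := exists_eq_smul_of_koopman_invariant hh
    rw [hone, L2.inner_indicatorConstLp_one] at hf0
    rw [L2.inner_indicatorConstLp_eq_inner_setIntegral, hf0, inner_zero_right]
  refine ⟨g, hg, ?_⟩
  have hfn : ‖χ - (a : ℂ) • one‖ ^ 2 = a * (1 - a) := by
    have h2 : inner ℂ χ one = (a : ℂ) := by rw [← inner_conj_symm, h1χ, Complex.conj_ofReal]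
    rw [norm_sub_sq (𝕜 := ℂ), hnorm hA, inner_smul_right, h2, norm_smul, mul_pow, hone1]
    simp only [RCLike.re_to_complex, ← Complex.ofReal_mul, Complex.ofReal_re, Complex.norm_real,
      Real.norm_eq_abs, sq_abs]
    ring
  have hinv1 : koopman ν g one = one := by
    rw [hone, koopman_indicatorConstLp]
    rfl
  -- the constant function drops out of the difference
  have hdiff : koopman ν g (χ - (a : ℂ) • one) - (χ - (a : ℂ) • one) = koopman ν g χ - χ := by
    rw [map_sub, map_smul, hinv1]
    abel
  have hsq := pow_le_pow_left₀ (by positivity) hle 2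
  rw [mul_pow, hfn, hdiff, norm_sub_sq (𝕜 := ℂ), (koopman ν g).norm_map, hnorm hA, hχ,
    koopman_indicatorConstLp, L2.inner_indicatorConstLp_one_indicatorConstLp_one] at hsq
  simp only [RCLike.re_to_complex, Complex.coe_algebraMap] at hsq
  refine hsq.trans (le_of_eq ?_)
  norm_cast
  ring

end GapOfSets

theorem isCompact_pow {G : Type u} [Monoid G] [TopologicalSpace G] [ContinuousMul G] {K : Set G}
    (hK : IsCompact K) : ∀ n : ℕ, IsCompact (K ^ n)
  | 0 => by simp
  | n + 1 => by rw [pow_succ]; exact (isCompact_pow hK n).mul hK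

section Decay

variable {G : Type u} [Group G] [TopologicalSpace G] [IsTopologicalGroup G] [T2Space G]
  [LocallyCompactSpace G] [MeasurableSpace G] [BorelSpace G]
  (Γ : Subgroup G) [DiscreteTopology Γ] [MeasurableSpace (G ⧸ Γ)] [BorelSpace (G ⧸ Γ)]
  (ν : Measure (G ⧸ Γ)) [IsProbabilityMeasure ν] [ν.Regular]
  [SMulInvariantMeasure G (G ⧸ Γ) ν]

/-- If `G/Γ` has spectral gap, then the mass outside the image of `Kⁿ` decays exponentially, for a
suitable compact neighbourhood `K` of the identity. -/
theorem HasSpectralGap.exists_exponential_decay (hgap : HasSpectralGap G ν) :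
    ∃ (K : Set G) (r : ℝ), IsCompact K ∧ K ∈ 𝓝 1 ∧ 0 ≤ r ∧ r < 1 ∧
      ∀ n : ℕ, ν.real (((↑) : G → G ⧸ Γ) '' (K ^ (n + 1)))ᶜ ≤ r ^ n := by
  obtain ⟨Q, ε, hQ, hε, hgap⟩ := hgap
  have := ergodicSMul_quotient Γ ν
  obtain ⟨K₀, hK₀, hQK₀⟩ := exists_compact_superset (hQ.insert 1)
  set K := K₀ ∪ K₀⁻¹
  have hK : IsCompact K := hK₀.union hK₀.inv
  have h1K₀ : K₀ ∈ 𝓝 (1 : G) := mem_interior_iff_mem_nhds.1 (hQK₀ (mem_insert _ _))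
  have h1K : K ∈ 𝓝 (1 : G) := mem_of_superset h1K₀ subset_union_left
  set B : ℕ → Set (G ⧸ Γ) := fun n => ((↑) : G → G ⧸ Γ) '' (K ^ (n + 1)) with hB
  have hBm : ∀ n, MeasurableSet (B n) := fun n =>
    (((isCompact_pow hK _).image QuotientGroup.continuous_mk).isClosed).measurableSet
  have hBsucc : ∀ {n : ℕ} {k : G} {y : G ⧸ Γ}, k ∈ K → y ∈ B n → k • y ∈ B (n + 1) := by
    rintro n k _ hk ⟨g, hg, rfl⟩
    exact ⟨k * g, by rw [pow_succ']; exact mul_mem_mul hk hg, rfl⟩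
  have hBmono : ∀ n, B n ⊆ B (n + 1) := fun n y hy => by
    simpa using hBsucc (mem_of_mem_nhds h1K) hy
  have hB0 : ∀ n, B 0 ⊆ B n := fun n => (monotone_nat_of_le_succ hBmono) (Nat.zero_le n)
  have hu : 0 < ν.real (B 0) := by
    have hpos := measure_isOpen_pos_of_smulInvariant_of_ne_zero G (μ := ν)
      (IsProbabilityMeasure.ne_zero ν)
      (QuotientGroup.isOpenMap_coe (N := Γ) _ (isOpen_interior (s := K)))
      ⟨_, 1, mem_interior_iff_mem_nhds.2 h1K, rfl⟩
    refine ENNReal.toReal_pos (hpos.trans_le (measure_mono ?_)).ne' (measure_ne_top _ _)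
    simp only [hB, zero_add, pow_one]
    exact image_mono interior_subset
  set δ : ℝ := ε ^ 2 * ν.real (B 0) / 2
  have hδ : 0 < δ := by positivity
  have hstep : ∀ n, (1 + δ) * ν.real (B (n + 1))ᶜ ≤ ν.real (B n)ᶜ := by
    intro n
    obtain ⟨q, hq, hle⟩ := exists_mem_sq_mul_measureReal_le hε hgap (hBm (n + 1)).compl
    have hqK : q ∈ K₀ := interior_subset (hQK₀ (mem_insert_of_mem _ hq))
    have hm : MeasurableSet ((fun y : G ⧸ Γ => q⁻¹ • y) ⁻¹' (B (n + 1))ᶜ) :=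
      (hBm (n + 1)).compl.preimage (measurable_const_smul q⁻¹)
    -- `q` maps the complement of `B (n + 1)` into that of `B n`, as `K` contains `q⁻¹`
    have hsub : (fun y : G ⧸ Γ => q⁻¹ • y) ⁻¹' (B (n + 1))ᶜ ∪ (B (n + 1))ᶜ ⊆ (B n)ᶜ := by
      refine union_subset (fun y hy hyn => hy ?_) (compl_subset_compl.2 (hBmono n))
      exact hBsucc (Or.inr (inv_mem_inv.2 hqK)) hyn
    have h1 := measureReal_union_add_inter (μ := ν)
      (s := (fun y : G ⧸ Γ => q⁻¹ • y) ⁻¹' (B (n + 1))ᶜ) (hBm (n + 1)).compl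
    have h2 : ν.real ((fun y : G ⧸ Γ => q⁻¹ • y) ⁻¹' (B (n + 1))ᶜ) = ν.real (B (n + 1))ᶜ := by
      rw [measureReal_def, measureReal_def, measure_preimage_smul]
    have h3 := measureReal_mono (μ := ν) hsub
    have h4 : ν.real (B 0) ≤ 1 - ν.real (B (n + 1))ᶜ := by
      rw [probReal_compl_eq_one_sub (hBm (n + 1))]
      linarith [measureReal_mono (μ := ν) (hB0 (n + 1))]
    have h5 : δ * ν.real (B (n + 1))ᶜ ≤
        ε ^ 2 * (ν.real (B (n + 1))ᶜ * (1 - ν.real (B (n + 1))ᶜ)) / 2 := by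
      have := mul_le_mul_of_nonneg_left h4
        (show 0 ≤ ε ^ 2 * ν.real (B (n + 1))ᶜ by positivity)
      simp only [δ]
      linarith
    linarith
  refine ⟨K, (1 + δ)⁻¹, hK, h1K, by positivity, inv_lt_one_of_one_lt₀ (by linarith), fun n => ?_⟩
  change ν.real (B n)ᶜ ≤ _
  induction n with
  | zero => simp [measureReal_le_one]
  | succ n ih =>
    rw [pow_succ, ← div_eq_mul_inv, le_div_iff₀ (by positivity), mul_comm]
    exact (hstep n).trans ih

end Decay

/-! ### Operators attached to functions, translations and restriction to a subgroup -/

section RightTranslation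

variable {G : Type u} [Group G] [TopologicalSpace G] [IsTopologicalGroup G]
  [LocallyCompactSpace G] [MeasurableSpace G] [BorelSpace G]

/-- The operator `π(f) π(h)` is of the form `π(f')`, where `f'` is, up to a scalar, a right
translate of `f`. -/
theorem exists_op_eq_op_mul (f : C_c(G, ℂ)) (h : G) :
    ∃ f' : C_c(G, ℂ), ∀ (E : BanachClass.{v}) (w : Weight G) (ρ : BoundedRep G E w),
      ρ.op f' = ρ.op f * ρ.π h := by
  let μ : Measure G := Measure.haar
  let μ' : Measure G := μ.map (· * h)
  let c : ℝ≥0 := Measure.haarScalarFactor μ' μ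
  let f₁ : C_c(G, ℂ) :=
    { toFun := fun g => f (g * h⁻¹)
      continuous_toFun := (map_continuous f).comp (continuous_mul_const _)
      hasCompactSupport' := f.hasCompactSupport.comp_homeomorph (Homeomorph.mulRight h⁻¹) }
  have hf₁ : ∀ g, f₁ g = f (g * h⁻¹) := fun g => rfl
  refine ⟨(c : ℂ) • f₁, fun E w ρ => ?_⟩
  ext x
  rw [mul_apply_eq_comp, BoundedRep.op_apply, BoundedRep.op_apply]
  refine (SeparatingDual.eq_iff_forall_dual_eq (R := ℝ)).2 fun L => ?_
  rw [← L.integral_comp_comm (ρ.integrable _ _), ← L.integral_comp_comm (ρ.integrable _ _)]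
  have hcont : Continuous fun g => L (f₁ g • ρ.π g x) :=
    L.continuous.comp ((map_continuous f₁).smul (ρ.strongly_continuous x))
  have hsupp : HasCompactSupport fun g => L (f₁ g • ρ.π g x) :=
    (f₁.hasCompactSupport.smul_right (f' := fun g => ρ.π g x)).comp_left (map_zero L)
  have key := Measure.integral_isMulLeftInvariant_eq_smul_of_hasCompactSupport μ' μ hcont hsupp
  rw [integral_smul_nnreal_measure, (measurableEmbedding_mulRight h).integral_map] at key
  calc ∫ g, L (((c : ℂ) • f₁) g • ρ.π g x) ∂μ = ∫ g, (c : ℝ) • L (f₁ g • ρ.π g x) ∂μ := by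
        refine integral_congr_ae (Eventually.of_forall fun g => ?_)
        simp only [CompactlySupportedContinuousMap.smul_apply, smul_assoc]
        rw [← L.map_smul]
        congr 1
    _ = c • ∫ g, L (f₁ g • ρ.π g x) ∂μ := integral_smul _ _
    _ = ∫ g, L (f g • ρ.π g (ρ.π h x)) ∂μ := by
        rw [← key]
        refine integral_congr_ae (Eventually.of_forall fun g => ?_)
        simp only [hf₁, mul_inv_cancel_right, map_mul, mul_apply_eq_comp]

end RightTranslation

/-- Over a discrete group, `π(h)` is a finite linear combination of the operators `π(γ)`. -/
theorem exists_op_eq_sum {D : Type u} [Group D] [TopologicalSpace D] [DiscreteTopology D]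
    [MeasurableSpace D] [BorelSpace D] (h : C_c(D, ℂ)) :
    ∃ (S : Finset D) (b : D → ℂ), ∀ (E : BanachClass.{v}) (w : Weight D) (ρ : BoundedRep D E w),
      ρ.op h = ∑ γ ∈ S, b γ • ρ.π γ := by
  have hfin : (tsupport h).Finite := isCompact_iff_finite.1 h.hasCompactSupport.isCompact
  refine ⟨hfin.toFinset, fun γ => ((Measure.haar : Measure D).real {γ} : ℂ) * h γ,
    fun E w ρ => ?_⟩
  ext x
  rw [BoundedRep.op_apply, ← setIntegral_eq_integral_of_forall_compl_eq_zero
    (s := (hfin.toFinset : Set D)), setIntegral_finset]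
  · simp [mul_smul]
  · exact (ρ.integrable h x).integrableOn
  · intro γ hγ
    rw [image_eq_zero_of_notMem_tsupport (f := h) (by simpa using hγ), zero_smul]

section Restriction

variable {G : Type u} [Group G] [TopologicalSpace G] {Γ : Subgroup G} {E : BanachClass.{v}}
  {ℓ : LengthFunction G} {s c : ℝ}

/-- The restriction to `Γ` of a representation of `G`. -/
def BoundedRep.restrict (Γ : Subgroup G) (ρ : BoundedRep G E (ℓ.weight s c)) :
    BoundedRep Γ E ((ℓ.restrict Γ).weight s c) where
  X := ρ.X
  mem := ρ.mem
  π := ρ.π.comp Γ.subtype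
  strongly_continuous x := (ρ.strongly_continuous x).comp continuous_subtype_val
  norm_le γ := ρ.norm_le γ

/-- The contraction induced on families of operators by the restriction of representations. -/
def restrictFamilies (Γ : Subgroup G) (E : BanachClass.{v}) (ℓ : LengthFunction G) (s c : ℝ) :
    Families E ((ℓ.restrict Γ).weight s c) →L[ℂ] Families E (ℓ.weight s c) :=
  LinearMap.mkContinuous
    { toFun := fun T => ⟨fun ρ => T (ρ.restrict Γ), memℓp_infty (by
        refine ⟨‖T‖, ?_⟩
        rintro _ ⟨ρ, rfl⟩
        exact lp.norm_apply_le_norm (by simp) T (ρ.restrict Γ))⟩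
      map_add' := fun T U => rfl
      map_smul' := fun a T => rfl } 1 (fun T => by
    rw [one_mul]
    exact lp.norm_le_of_forall_le (norm_nonneg _)
      fun ρ => lp.norm_apply_le_norm (by simp) T (ρ.restrict Γ))

variable [IsTopologicalGroup G] [LocallyCompactSpace G] [MeasurableSpace G] [BorelSpace G]
  [DiscreteTopology Γ]

/-- Multiplication by an element of `C_c(G)` maps `𝒞_{w,E}(Γ)` to `𝒞_{w,E}(G)`. -/
theorem toFamilies_mul_restrictFamilies_mem (f : C_c(G, ℂ))
    (a : groupAlgebra E ((ℓ.restrict Γ).weight s c)) :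
    toFamilies E (ℓ.weight s c) f * restrictFamilies Γ E ℓ s c a ∈
      groupAlgebra E (ℓ.weight s c) := by
  have hcont : Continuous fun T => toFamilies E (ℓ.weight s c) f * restrictFamilies Γ E ℓ s c T :=
    continuous_const.mul (restrictFamilies Γ E ℓ s c).continuous
  refine map_mem_closure hcont (s := (convImage E ((ℓ.restrict Γ).weight s c) : Set _))
    (t := (convImage E (ℓ.weight s c) : Set _)) a.2 ?_
  rintro _ ⟨h, rfl⟩
  obtain ⟨S, b, hS⟩ := exists_op_eq_sum.{u, v} h
  choose f' hf' using fun γ : Γ => exists_op_eq_op_mul.{u, v} f (γ : G)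
  refine ⟨∑ γ ∈ S, b γ • f' γ, ?_⟩
  ext1
  funext ρ
  have h1 : (toFamilies E (ℓ.weight s c) f * restrictFamilies Γ E ℓ s c
      (toFamilies E ((ℓ.restrict Γ).weight s c) h)) ρ = ρ.op f * ∑ γ ∈ S, b γ • ρ.π γ :=
    congrArg (fun T : ρ.X →L[ℂ] ρ.X => ρ.op f * T) (hS E _ (ρ.restrict Γ))
  refine Eq.trans ?_ h1.symm
  rw [map_sum, lp.coeFn_sum, Finset.sum_apply, Finset.mul_sum]
  refine Finset.sum_congr rfl fun γ _ => ?_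
  rw [map_smul, mul_smul_comm, ← hf']
  rfl

end Restriction

/-! ### Averaging invariant vectors over the quotient -/

theorem norm_integral_le_of_forall_notMem {Y : Type u} [MeasurableSpace Y] {ν : Measure Y}
    [IsFiniteMeasure ν] {X : Type v} [NormedAddCommGroup X] [NormedSpace ℝ X] {F : Y → X}
    {S : Set Y} {C : ℝ} (h0 : ∀ y, y ∉ S → F y = 0) (hC : ∀ y, ‖F y‖ ≤ C) :
    ‖∫ y, F y ∂ν‖ ≤ C * ν.real S := by
  rw [← setIntegral_eq_integral_of_forall_compl_eq_zero h0]
  exact norm_setIntegral_le_of_norm_le_const (measure_lt_top ν S) fun y _ => hC y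

/-- Compactly supported cut-off functions adapted to the images of the powers of a compact
neighbourhood of the identity. -/
theorem exists_cutoff {G : Type u} [Group G] [TopologicalSpace G] [IsTopologicalGroup G]
    [T2Space G] [LocallyCompactSpace G] (Γ : Subgroup G) [DiscreteTopology Γ] {K : Set G}
    (hK : IsCompact K) (hK1 : K ∈ 𝓝 1) (n : ℕ) :
    ∃ k : C_c(G ⧸ Γ, ℝ), (∀ x, k x ∈ Icc (0 : ℝ) 1) ∧
      (∀ x ∈ ((↑) : G → G ⧸ Γ) '' (K ^ (n + 1)), k x = 1) ∧
      (∀ x ∉ ((↑) : G → G ⧸ Γ) '' (K ^ (n + 2)), k x = 0) := by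
  set U : Set (G ⧸ Γ) := ((↑) : G → G ⧸ Γ) '' (interior K * K ^ (n + 1))
  have hU : IsOpen U := QuotientGroup.isOpenMap_coe _ isOpen_interior.mul_right
  have hsub : ((↑) : G → G ⧸ Γ) '' (K ^ (n + 1)) ⊆ U := by
    refine image_mono fun g hg => ⟨1, mem_interior_iff_mem_nhds.2 hK1, g, hg, one_mul g⟩
  have hU2 : U ⊆ ((↑) : G → G ⧸ Γ) '' (K ^ (n + 2)) := by
    rw [pow_succ' K (n + 1)]
    exact image_mono (mul_subset_mul_right interior_subset)
  obtain ⟨k, hk1, hk0, hkc, hk⟩ := exists_continuous_one_zero_of_isCompact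
    ((isCompact_pow hK (n + 1)).image (QuotientGroup.continuous_mk (N := Γ))) hU.isClosed_compl
    (disjoint_compl_right_iff_subset.2 hsub)
  exact ⟨⟨k, hkc⟩, hk, fun x hx => hk1 hx, fun x hx => hk0 fun hxU => hx (hU2 hxU)⟩

section OrbitMap

variable {G : Type u} [Group G] [TopologicalSpace G] {Γ : Subgroup G} {E : BanachClass.{v}}
  {w : Weight G}

/-- The map `gΓ ↦ π(g) η`, for a `Γ`-invariant vector `η`. -/
def BoundedRep.orbitMap (ρ : BoundedRep G E w) {η : ρ.X} (hη : ∀ γ : Γ, ρ.π γ η = η) :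
    G ⧸ Γ → ρ.X :=
  Quotient.lift (fun g : G => ρ.π g η) (by
    intro a b hab
    have h : a⁻¹ * b ∈ Γ := QuotientGroup.leftRel_apply.1 hab
    have h1 := hη ⟨_, h⟩
    change ρ.π a η = ρ.π b η
    conv_lhs => rw [← h1]
    rw [← mul_apply_eq_comp, ← map_mul, mul_inv_cancel_left])

variable (ρ : BoundedRep G E w) {η : ρ.X} (hη : ∀ γ : Γ, ρ.π γ η = η)

theorem BoundedRep.orbitMap_mk (g : G) : ρ.orbitMap hη (g : G ⧸ Γ) = ρ.π g η := rfl

theorem BoundedRep.continuous_orbitMap : Continuous (ρ.orbitMap hη) :=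
  (QuotientGroup.isQuotientMap_mk Γ).continuous_iff.2 (ρ.strongly_continuous η)

theorem BoundedRep.orbitMap_smul (h : G) (x : G ⧸ Γ) :
    ρ.orbitMap hη (h • x) = ρ.π h (ρ.orbitMap hη x) := by
  obtain ⟨g, rfl⟩ := QuotientGroup.mk_surjective x
  change ρ.π (h * g) η = ρ.π h (ρ.π g η)
  rw [map_mul, mul_apply_eq_comp]

theorem BoundedRep.norm_smul_orbitMap_le {k : C_c(G ⧸ Γ, ℝ)} {S' : Set (G ⧸ Γ)} {C : ℝ}
    (hk : ∀ x, k x ∈ Icc (0 : ℝ) 1) (hk0 : ∀ x ∉ S', k x = 0) (hC0 : 0 ≤ C)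
    (hC : ∀ x ∈ S', ‖ρ.orbitMap hη x‖ ≤ C) (x : G ⧸ Γ) : ‖k x • ρ.orbitMap hη x‖ ≤ C := by
  rw [norm_smul, Real.norm_eq_abs, abs_of_nonneg (hk x).1]
  by_cases hx : x ∈ S'
  · exact (mul_le_of_le_one_left (norm_nonneg _) (hk x).2).trans (hC x hx)
  · rw [hk0 x hx, zero_mul]
    exact hC0

variable [MeasurableSpace (G ⧸ Γ)] [BorelSpace (G ⧸ Γ)] {ν : Measure (G ⧸ Γ)}

theorem BoundedRep.integrable_smul_orbitMap [IsFiniteMeasureOnCompacts ν] (k : C_c(G ⧸ Γ, ℝ)) :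
    Integrable (fun x => k x • ρ.orbitMap hη x) ν :=
  ((map_continuous k).smul (ρ.continuous_orbitMap hη)).integrable_of_hasCompactSupport
    k.hasCompactSupport.smul_right

/-- Two averages of the same vector differ by little if the densities agree on a large set. -/
theorem BoundedRep.norm_integral_sub_integral_orbitMap_le [IsFiniteMeasure ν]
    {k k' : C_c(G ⧸ Γ, ℝ)} {S S' : Set (G ⧸ Γ)} {C : ℝ}
    (hk : ∀ x, k x ∈ Icc (0 : ℝ) 1) (hk' : ∀ x, k' x ∈ Icc (0 : ℝ) 1)
    (hkk' : ∀ x ∈ S, k x = k' x) (hk0 : ∀ x ∉ S', k x = 0) (hk0' : ∀ x ∉ S', k' x = 0)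
    (hC0 : 0 ≤ C) (hC : ∀ x ∈ S', ‖ρ.orbitMap hη x‖ ≤ C) :
    ‖∫ x, k x • ρ.orbitMap hη x ∂ν - ∫ x, k' x • ρ.orbitMap hη x ∂ν‖ ≤ 2 * C * ν.real Sᶜ := by
  rw [← integral_sub (ρ.integrable_smul_orbitMap hη _) (ρ.integrable_smul_orbitMap hη _)]
  refine norm_integral_le_of_forall_notMem (fun x hx => ?_) fun x => ?_
  · rw [hkk' x (notMem_compl_iff.1 hx), sub_self]
  · rw [two_mul]
    exact (norm_sub_le _ _).trans (add_le_add (ρ.norm_smul_orbitMap_le hη hk hk0 hC0 hC x)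
      (ρ.norm_smul_orbitMap_le hη hk' hk0' hC0 hC x))

/-- An average whose density is one on a large set is almost invariant. -/
theorem BoundedRep.norm_map_integral_orbitMap_sub_le [IsTopologicalGroup G]
    [IsFiniteMeasure ν] [SMulInvariantMeasure G (G ⧸ Γ) ν]
    {k : C_c(G ⧸ Γ, ℝ)} {S S' : Set (G ⧸ Γ)} {C : ℝ}
    (hk : ∀ x, k x ∈ Icc (0 : ℝ) 1) (hk1 : ∀ x ∈ S, k x = 1) (hk0 : ∀ x ∉ S', k x = 0)
    (hC0 : 0 ≤ C) (hC : ∀ x ∈ S', ‖ρ.orbitMap hη x‖ ≤ C) (h : G) :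
    ‖ρ.π h (∫ x, k x • ρ.orbitMap hη x ∂ν) - ∫ x, k x • ρ.orbitMap hη x ∂ν‖ ≤
      2 * (‖ρ.π h‖ + 1) * C * ν.real Sᶜ := by
  have h1 : ρ.π h (∫ x, k x • ρ.orbitMap hη x ∂ν) =
      ∫ x, translate h⁻¹ k x • ρ.orbitMap hη x ∂ν := by
    rw [← (ρ.π h).integral_comp_comm (ρ.integrable_smul_orbitMap hη _),
      ← integral_smul_eq_self (fun x => translate h⁻¹ k x • ρ.orbitMap hη x) (g := h)]
    refine integral_congr_ae (Eventually.of_forall fun x => ?_)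
    change ρ.π h (k x • _) = k (h⁻¹ • h • x) • _
    rw [inv_smul_smul, ρ.orbitMap_smul, ContinuousLinearMap.map_smul_of_tower]
  rw [h1, ← integral_sub (ρ.integrable_smul_orbitMap hη _) (ρ.integrable_smul_orbitMap hη _)]
  refine (norm_integral_le_of_forall_notMem (S := Sᶜ ∪ (fun x => h⁻¹ • x) ⁻¹' Sᶜ)
    (C := (‖ρ.π h‖ + 1) * C) (fun x hx => ?_) fun x => ?_).trans ?_
  · rw [mem_union, not_or, notMem_compl_iff, mem_preimage, notMem_compl_iff] at hx
    change k (h⁻¹ • x) • _ - _ = _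
    rw [hk1 x hx.1, hk1 _ hx.2, sub_self]
  · have h2 := ρ.norm_smul_orbitMap_le hη hk hk0 hC0 hC
    have h3 : ‖k (h⁻¹ • x) • ρ.orbitMap hη x‖ ≤ ‖ρ.π h‖ * C := by
      have h4 : ρ.orbitMap hη x = ρ.π h (ρ.orbitMap hη (h⁻¹ • x)) := by
        rw [← ρ.orbitMap_smul, smul_inv_smul]
      rw [h4, ← ContinuousLinearMap.map_smul_of_tower]
      exact ((ρ.π h).le_opNorm _).trans (mul_le_mul_of_nonneg_left (h2 _) (norm_nonneg _))
    rw [add_mul, one_mul]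
    exact (norm_sub_le _ _).trans (add_le_add h3 (h2 x))
  · have h5 : ν.real (Sᶜ ∪ (fun x => h⁻¹ • x) ⁻¹' Sᶜ) ≤ 2 * ν.real Sᶜ := by
      refine (measureReal_union_le _ _).trans (le_of_eq ?_)
      have h6 : ν.real ((fun x => h⁻¹ • x) ⁻¹' Sᶜ) = ν.real Sᶜ := by
        rw [measureReal_def, measureReal_def, measure_preimage_smul]
      rw [h6, two_mul]
    calc (‖ρ.π h‖ + 1) * C * _ ≤ (‖ρ.π h‖ + 1) * C * (2 * ν.real Sᶜ) :=
          mul_le_mul_of_nonneg_left h5 (by positivity)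
      _ = _ := by ring

/-- An average of a `G`-invariant vector, with density one on a large set, is close to it. -/
theorem BoundedRep.norm_integral_orbitMap_sub_le [IsProbabilityMeasure ν]
    {k : C_c(G ⧸ Γ, ℝ)} {S : Set (G ⧸ Γ)}
    (hk : ∀ x, k x ∈ Icc (0 : ℝ) 1) (hk1 : ∀ x ∈ S, k x = 1) (hinv : η ∈ ρ.invariants) :
    ‖∫ x, k x • ρ.orbitMap hη x ∂ν - η‖ ≤ ‖η‖ * ν.real Sᶜ := by
  have h1 : ∀ x, ρ.orbitMap hη x = η := by
    intro x
    obtain ⟨g, rfl⟩ := QuotientGroup.mk_surjective x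
    exact hinv g
  have h2 : ∫ x, k x • ρ.orbitMap hη x ∂ν - η = ∫ x, (k x • ρ.orbitMap hη x - η) ∂ν := by
    rw [integral_sub (ρ.integrable_smul_orbitMap hη _) (integrable_const η)]
    simp
  rw [h2]
  refine norm_integral_le_of_forall_notMem (fun x hx => ?_) fun x => ?_
  · rw [hk1 x (notMem_compl_iff.1 hx), h1, one_smul, sub_self]
  · have h3 : k x • η - η = (k x - 1) • η := by rw [sub_smul, one_smul]
    rw [h1, h3, norm_smul]
    refine mul_le_of_le_one_left (norm_nonneg _) ?_
    rw [Real.norm_eq_abs, abs_le]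
    constructor <;> linarith [(hk x).1, (hk x).2]

end OrbitMap

section Averaging

variable {G : Type u} [Group G] [TopologicalSpace G] [IsTopologicalGroup G] [T2Space G]
  [LocallyCompactSpace G] [MeasurableSpace G] [BorelSpace G]
  {Γ : Subgroup G} [DiscreteTopology Γ] [MeasurableSpace (G ⧸ Γ)] [BorelSpace (G ⧸ Γ)]
  {ν : Measure (G ⧸ Γ)} [SMulInvariantMeasure G (G ⧸ Γ) ν]

variable (Γ ν) in
/-- Averaging a `Γ`-invariant vector over `G/Γ` with a compactly supported density `k` is the
action of an element of `C_c(G)`, which does not depend on the representation. -/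
theorem exists_op_eq_integral_orbitMap [IsFiniteMeasureOnCompacts ν] (k : C_c(G ⧸ Γ, ℝ)) :
    ∃ f : C_c(G, ℂ), ∀ (E : BanachClass.{v}) (w : Weight G) (ρ : BoundedRep G E w) (η : ρ.X)
      (hη : ∀ γ : Γ, ρ.π γ η = η), ρ.op f η = ∫ x, k x • ρ.orbitMap hη x ∂ν := by
  obtain ⟨κ, hκ⟩ := exists_integral_orbitSum_eq Γ ν
  obtain ⟨f, rfl⟩ := orbitSum_surjective Γ k
  let f' : C_c(G, ℂ) :=
    { toFun := fun g => ((κ * f g : ℝ) : ℂ)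
      continuous_toFun := Complex.continuous_ofReal.comp
        (continuous_const.mul (map_continuous f))
      hasCompactSupport' := (f.hasCompactSupport.mul_left (f := fun _ => (κ : ℝ))).comp_left
        Complex.ofReal_zero }
  refine ⟨f', fun E w ρ η hη => ?_⟩
  rw [BoundedRep.op_apply, integral_orbitSum_smul Γ hκ f (ρ.continuous_orbitMap hη),
    ← integral_smul]
  refine integral_congr_ae (Eventually.of_forall fun g => ?_)
  change ((κ * f g : ℝ) : ℂ) • ρ.π g η = (κ : ℝ) • f g • ρ.π g η
  rw [Complex.coe_smul, mul_smul]

end Averaging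

/-- The operators `π(a)` are bounded uniformly in `π`. -/
theorem exists_norm_ext_apply_le {G : Type u} [Group G] [TopologicalSpace G] [IsTopologicalGroup G]
    [LocallyCompactSpace G] [MeasurableSpace G] [BorelSpace G] {E : BanachClass.{v}} {w : Weight G}
    (a : groupAlgebra E w) :
    ∃ p : ℝ, 0 ≤ p ∧ ∀ (ρ : BoundedRep G E w) (x : ρ.X), ‖ρ.ext a x‖ ≤ p * ‖x‖ :=
  ⟨‖a.1‖, norm_nonneg _, fun ρ x => ((ρ.ext a).le_opNorm x).trans
    (mul_le_mul_of_nonneg_right (lp.norm_apply_le_norm (by simp) a.1 ρ) (norm_nonneg x))⟩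

section Limit

variable {G : Type u} [Group G] [TopologicalSpace G] [IsTopologicalGroup G]
  [LocallyCompactSpace G] [MeasurableSpace G] [BorelSpace G]
  {Γ : Subgroup G} [DiscreteTopology Γ]

/-- If `P` is a Kazhdan projection for `Γ` and the elements `F n` of `C_c(G)` average the
`Γ`-invariant vectors in the limit, at a geometric rate, then the sequence `F n * P` converges to a
Kazhdan projection for `G`. -/
theorem hasKazhdanProjection_of_averaging {ℓ : LengthFunction G} {E : BanachClass.{v}} {s c : ℝ}
    (hΓ : HasKazhdanProjection E ((ℓ.restrict Γ).weight s c)) (F : ℕ → C_c(G, ℂ)) {C q : ℝ}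
    (hC : 0 ≤ C) (hq0 : 0 ≤ q) (hq : q < 1)
    (hcauchy : ∀ (ρ : BoundedRep G E (ℓ.weight s c)) (η : ρ.X), (∀ γ : Γ, ρ.π γ η = η) →
      ∀ n, ‖ρ.op (F n) η - ρ.op (F (n + 1)) η‖ ≤ C * ‖η‖ * q ^ n)
    (hinvar : ∀ (ρ : BoundedRep G E (ℓ.weight s c)) (η : ρ.X), (∀ γ : Γ, ρ.π γ η = η) →
      ∀ (h : G), Tendsto (fun n => ρ.π h (ρ.op (F n) η) - ρ.op (F n) η) atTop (𝓝 0))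
    (hfix : ∀ (ρ : BoundedRep G E (ℓ.weight s c)) (x : ρ.X), x ∈ ρ.invariants →
      Tendsto (fun n => ρ.op (F n) x) atTop (𝓝 x)) :
    HasKazhdanProjection E (ℓ.weight s c) := by
  obtain ⟨P, -, hP⟩ := hΓ
  set A : ℕ → Families E (ℓ.weight s c) := fun n =>
    toFamilies E (ℓ.weight s c) (F n) * restrictFamilies Γ E ℓ s c P with hA
  have hPinv : ∀ (ρ : BoundedRep G E (ℓ.weight s c)) (x : ρ.X) (γ : Γ),
      ρ.π γ ((ρ.restrict Γ).ext P x : ρ.X) = ((ρ.restrict Γ).ext P x : ρ.X) :=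
    fun ρ x γ => (hP (ρ.restrict Γ)).map_mem x γ
  obtain ⟨p, hp0, hp⟩ := exists_norm_ext_apply_le P
  have hPnorm : ∀ (ρ : BoundedRep G E (ℓ.weight s c)) (x : ρ.X),
      ‖((ρ.restrict Γ).ext P x : ρ.X)‖ ≤ p * ‖x‖ := fun ρ x => hp (ρ.restrict Γ) x
  have hAc : CauchySeq A := by
    refine cauchySeq_of_le_geometric q (C * p) hq fun n => ?_
    rw [dist_eq_norm]
    have hC' : 0 ≤ C * p * q ^ n := by positivity
    refine lp.norm_le_of_forall_le hC' fun ρ =>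
      ContinuousLinearMap.opNorm_le_bound _ hC' fun x => ?_
    refine (hcauchy ρ _ (hPinv ρ x) n).trans ?_
    calc C * ‖((ρ.restrict Γ).ext P x : ρ.X)‖ * q ^ n
        ≤ C * (p * ‖x‖) * q ^ n :=
          mul_le_mul_of_nonneg_right (mul_le_mul_of_nonneg_left (hPnorm ρ x) hC) (by positivity)
      _ = _ := by ring
  obtain ⟨T, hT⟩ := cauchySeq_tendsto_of_complete hAc
  have hTmem : T ∈ groupAlgebra E (ℓ.weight s c) :=
    isClosed_closure.mem_of_tendsto hT (Eventually.of_forall fun n =>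
      toFamilies_mul_restrictFamilies_mem (F n) P)
  have hTx : ∀ (ρ : BoundedRep G E (ℓ.weight s c)) (x : ρ.X),
      Tendsto (fun n => ρ.op (F n) ((ρ.restrict Γ).ext P x)) atTop (𝓝 (T ρ x)) := by
    intro ρ x
    have h1 : Tendsto (fun n => A n ρ) atTop (𝓝 (T ρ)) := by
      rw [tendsto_iff_norm_sub_tendsto_zero] at hT ⊢
      exact squeeze_zero (fun _ => norm_nonneg _)
        (fun n => lp.norm_apply_le_norm (by simp) (A n - T) ρ) hT
    exact ((ContinuousLinearMap.apply ℂ ρ.X x).continuous.tendsto _).comp h1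
  have hproj : ∀ ρ : BoundedRep G E (ℓ.weight s c), LinearMap.IsProj ρ.invariants (T ρ) := by
    intro ρ
    refine ⟨fun x h => ?_, fun x hx => ?_⟩
    · have h1 := ((ρ.π h).continuous.tendsto _).comp (hTx ρ x)
      have h2 := h1.sub (hTx ρ x)
      exact sub_eq_zero.1 (tendsto_nhds_unique h2 (hinvar ρ _ (hPinv ρ x) h))
    · have h1 : ((ρ.restrict Γ).ext P x : ρ.X) = x :=
        (hP (ρ.restrict Γ)).map_id x fun γ => hx γ
      have h2 := hTx ρ x
      rw [h1] at h2
      exact tendsto_nhds_unique h2 (hfix ρ x hx)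
  refine ⟨⟨T, hTmem⟩, Subtype.ext ?_, hproj⟩
  ext ρ x
  exact (hproj ρ).map_id _ ((hproj ρ).map_mem x)

end Limit

section ExponentialDecay

theorem LengthFunction.le_of_mem_pow {G : Type u} [Group G] [TopologicalSpace G]
    (ℓ : LengthFunction G) {K : Set G} {L : ℝ} (hL : ∀ g ∈ K, ℓ.toFun g ≤ L) :
    ∀ n : ℕ, ∀ g ∈ K ^ (n + 1), ℓ.toFun g ≤ (n + 1) * L := by
  intro n
  induction n with
  | zero => simpa using hL
  | succ n ih =>
    intro g hg
    rw [pow_succ] at hg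
    obtain ⟨a, ha, b, hb, rfl⟩ := hg
    push_cast
    linarith [ih a ha, hL b hb, ℓ.mul_le a b]

variable {G : Type u} [Group G] [TopologicalSpace G] [IsTopologicalGroup G] [T2Space G]
  [LocallyCompactSpace G] [MeasurableSpace G] [BorelSpace G]
  {Γ : Subgroup G} [DiscreteTopology Γ] [MeasurableSpace (G ⧸ Γ)] [BorelSpace (G ⧸ Γ)]
  {ν : Measure (G ⧸ Γ)} [IsProbabilityMeasure ν] [SMulInvariantMeasure G (G ⧸ Γ) ν]

/-- Kazhdan projections pass from `Γ` to `G` as soon as the mass of `G/Γ` outside the image of `Kⁿ`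
decays faster than `exp (s₀ ℓ)` grows. -/
theorem hasKazhdanProjection_of_exponential_decay {ℓ : LengthFunction G} {K : Set G} {r L : ℝ}
    (hK : IsCompact K) (hK1 : K ∈ 𝓝 1) (hr0 : 0 ≤ r)
    (hdecay : ∀ n : ℕ, ν.real (((↑) : G → G ⧸ Γ) '' (K ^ (n + 1)))ᶜ ≤ r ^ n)
    (hL : ∀ g ∈ K, ℓ.toFun g ≤ L) {s₀ : ℝ} (hs₀ : 0 ≤ s₀) (hr : Real.exp (s₀ * L) * r < 1)
    {E : BanachClass.{v}} {s c : ℝ} (hs : s ≤ s₀)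
    (hΓ : HasKazhdanProjection E ((ℓ.restrict Γ).weight s c)) :
    HasKazhdanProjection E (ℓ.weight s c) := by
  set B : ℕ → Set (G ⧸ Γ) := fun n => ((↑) : G → G ⧸ Γ) '' (K ^ (n + 1)) with hB
  have hL0 : 0 ≤ L := (ℓ.nonneg 1).trans (hL 1 (mem_of_mem_nhds hK1))
  have hBmono : Monotone B := monotone_nat_of_le_succ fun n => by
    refine image_mono ?_
    rw [pow_succ' K (n + 1)]
    exact fun g hg => ⟨1, mem_of_mem_nhds hK1, g, hg, one_mul g⟩
  set M : ℕ → ℝ := fun n => Real.exp (s₀ * ((n + 1) * L) + c) with hM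
  have hM0 : ∀ n, 0 ≤ M n := fun n => (Real.exp_pos _).le
  set q : ℝ := Real.exp (s₀ * L) * r with hq
  have hq0 : 0 ≤ q := mul_nonneg (Real.exp_pos _).le hr0
  have hr1 : r < 1 :=
    (le_mul_of_one_le_left hr0 (Real.one_le_exp (mul_nonneg hs₀ hL0))).trans_lt hr
  have hMr : ∀ j n : ℕ, M (n + j) * r ^ n = M j * q ^ n := by
    intro j n
    rw [hq, mul_pow, ← Real.exp_nat_mul, ← mul_assoc, hM]
    simp only
    rw [← Real.exp_add]
    congr 2
    push_cast
    ring
  have horbit : ∀ (ρ : BoundedRep G E (ℓ.weight s c)) (η : ρ.X) (hη : ∀ γ : Γ, ρ.π γ η = η) (n : ℕ)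
      (x : G ⧸ Γ), x ∈ B n → ‖ρ.orbitMap hη x‖ ≤ M n * ‖η‖ := by
    rintro ρ η hη n _ ⟨g, hg, rfl⟩
    rw [ρ.orbitMap_mk]
    refine ((ρ.π g).le_opNorm η).trans (mul_le_mul_of_nonneg_right ?_ (norm_nonneg _))
    refine (ρ.norm_le g).trans (Real.exp_le_exp.2 ?_)
    change s * ℓ.toFun g + c ≤ s₀ * ((n + 1) * L) + c
    have h1 := mul_le_mul_of_nonneg_right hs (ℓ.nonneg g)
    have h2 := mul_le_mul_of_nonneg_left (ℓ.le_of_mem_pow hL n g hg) hs₀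
    linarith
  choose k hk hk1 hk0 using fun n => exists_cutoff Γ hK hK1 n
  choose F hF using fun n => exists_op_eq_integral_orbitMap.{u, v} Γ ν (k n)
  refine hasKazhdanProjection_of_averaging hΓ F (C := 2 * M 2) (q := q)
    (mul_nonneg zero_le_two (hM0 2)) hq0 hr ?_ ?_ ?_
  · intro ρ η hη n
    rw [hF _ E _ ρ η hη, hF _ E _ ρ η hη]
    have hMη : 0 ≤ M (n + 2) * ‖η‖ := mul_nonneg (hM0 _) (norm_nonneg _)
    refine (ρ.norm_integral_sub_integral_orbitMap_le hη (S := B n) (S' := B (n + 2)) (hk n)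
      (hk (n + 1)) (fun x hx => ?_) (fun x hx => hk0 n x fun h => hx (hBmono (Nat.le_succ _) h))
      (hk0 (n + 1)) hMη (horbit ρ η hη (n + 2))).trans ?_
    · rw [hk1 n x hx, hk1 (n + 1) x (hBmono (Nat.le_succ n) hx)]
    · calc 2 * (M (n + 2) * ‖η‖) * ν.real (B n)ᶜ ≤ 2 * (M (n + 2) * ‖η‖) * r ^ n :=
            mul_le_mul_of_nonneg_left (hdecay n) (by positivity)
        _ = 2 * (M (n + 2) * r ^ n) * ‖η‖ := by ring
        _ = _ := by rw [hMr]; ring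
  · intro ρ η hη h
    have hlim : Tendsto (fun n => 2 * (‖ρ.π h‖ + 1) * M 1 * ‖η‖ * q ^ n) atTop (𝓝 0) := by
      simpa using (tendsto_pow_atTop_nhds_zero_of_lt_one hq0 hr).const_mul
        (2 * (‖ρ.π h‖ + 1) * M 1 * ‖η‖)
    refine squeeze_zero_norm (fun n => ?_) hlim
    rw [hF _ E _ ρ η hη]
    have hMη : 0 ≤ M (n + 1) * ‖η‖ := mul_nonneg (hM0 _) (norm_nonneg _)
    refine (ρ.norm_map_integral_orbitMap_sub_le hη (hk n) (hk1 n) (hk0 n) hMη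
      (horbit ρ η hη (n + 1)) h).trans ?_
    calc 2 * (‖ρ.π h‖ + 1) * (M (n + 1) * ‖η‖) * ν.real (B n)ᶜ
        ≤ 2 * (‖ρ.π h‖ + 1) * (M (n + 1) * ‖η‖) * r ^ n :=
          mul_le_mul_of_nonneg_left (hdecay n) (by positivity)
      _ = 2 * (‖ρ.π h‖ + 1) * (M (n + 1) * r ^ n) * ‖η‖ := by ring
      _ = _ := by rw [hMr]; ring
  · intro ρ x hx
    have hlim : Tendsto (fun n => ‖x‖ * r ^ n) atTop (𝓝 0) := by
      simpa using (tendsto_pow_atTop_nhds_zero_of_lt_one hr0 hr1).const_mul ‖x‖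
    rw [tendsto_iff_norm_sub_tendsto_zero]
    refine squeeze_zero (fun _ => norm_nonneg _) (fun n => ?_) hlim
    have hxΓ : ∀ γ : Γ, ρ.π γ x = x := fun γ => hx γ
    rw [hF _ E _ ρ x hxΓ]
    exact (ρ.norm_integral_orbitMap_sub_le hxΓ (hk n) (hk1 n) hx).trans
      (mul_le_mul_of_nonneg_left (hdecay n) (norm_nonneg _))

end ExponentialDecay

/-! ### From Kazhdan projections to spectral gap -/

section Koopman

variable {G : Type u} [Group G] {Y : Type v} [MulAction G Y] [MeasurableSpace Y]
  [MeasurableConstSMul G Y] (ν : Measure Y) [SMulInvariantMeasure G Y ν]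

theorem koopman_apply_eq_smul (g : G) (f : Lp ℂ 2 ν) :
    koopman ν g f = DomMulAct.mk g⁻¹ • f := rfl

theorem koopman_mul_apply (g h : G) (f : Lp ℂ 2 ν) :
    koopman ν (g * h) f = koopman ν g (koopman ν h f) := by
  simp only [koopman_apply_eq_smul, mul_inv_rev, DomMulAct.mk_mul, mul_smul]

variable (G) in
/-- The Koopman representation as a homomorphism to the bounded operators. -/
def koopmanHom : G →* (Lp ℂ 2 ν →L[ℂ] Lp ℂ 2 ν) where
  toFun g := (koopman ν g).toContinuousLinearMap
  map_one' := by
    ext1 f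
    change koopman ν (1 : G) f = f
    rw [koopman_apply_eq_smul, inv_one, DomMulAct.mk_one, one_smul]
  map_mul' g h := by
    ext1 f
    exact koopman_mul_apply ν g h f

theorem koopman_inv_koopman (g : G) (f : Lp ℂ 2 ν) : koopman ν g⁻¹ (koopman ν g f) = f := by
  rw [← koopman_mul_apply, inv_mul_cancel, koopman_apply_eq_smul, inv_one, DomMulAct.mk_one,
    one_smul]

/-- The restriction of the Koopman representation along a homomorphism `φ`. The weight is only
required to be nonnegative, the representation being unitary. -/
def koopmanRep [TopologicalSpace G] [MeasurableSpace G] [OpensMeasurableSpace G]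
    [TopologicalSpace Y] [R1Space Y] [BorelSpace Y] [ContinuousSMul G Y] [IsTopologicalGroup G]
    [IsLocallyFiniteMeasure ν] [ν.InnerRegularCompactLTTop]
    {D : Type u} [Group D] [TopologicalSpace D] (φ : D →* G) (hφ : Continuous φ) (w : Weight D)
    (hw : ∀ d, 0 ≤ w.toFun d) : BoundedRep D hilbertClass.{v} w where
  X := Lp ℂ 2 ν
  mem := ⟨inferInstance, rfl⟩
  π := (koopmanHom G ν).comp φ
  strongly_continuous f := by
    have : Fact ((2 : ℝ≥0∞) ≠ ∞) := ⟨by simp⟩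
    change Continuous fun d => DomMulAct.mk (φ d)⁻¹ • f
    exact ((DomMulAct.continuous_mk.comp hφ.inv).smul continuous_const)
  norm_le d := by
    refine ((koopman ν (φ d)).norm_toContinuousLinearMap_le).trans ?_
    exact Real.one_le_exp (hw d)

end Koopman

/-- Over a discrete group, an element of the algebra is approximated, uniformly over all
representations, by finite linear combinations of the operators `π(γ)`. -/
theorem exists_norm_ext_sub_sum_le {D : Type u} [Group D] [TopologicalSpace D] [DiscreteTopology D]
    [MeasurableSpace D] [BorelSpace D] {E : BanachClass.{v}} {w : Weight D} (a : groupAlgebra E w)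
    {ε : ℝ} (hε : 0 < ε) :
    ∃ (S : Finset D) (b : D → ℂ), ∀ (ρ : BoundedRep D E w) (x : ρ.X),
      ‖ρ.ext a x - ∑ γ ∈ S, b γ • ρ.π γ x‖ ≤ ε * ‖x‖ := by
  obtain ⟨_, ⟨h, rfl⟩, hdist⟩ := Metric.mem_closure_iff.1 a.2 ε hε
  obtain ⟨S, b, hS⟩ := exists_op_eq_sum.{u, v} h
  refine ⟨S, b, fun ρ x => ?_⟩
  have hclose : ‖ρ.ext a - ρ.op h‖ ≤ ε := by
    rw [dist_eq_norm] at hdist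
    exact (lp.norm_apply_le_norm (by simp) (a.1 - toFamilies E w h) ρ).trans hdist.le
  have hop : ρ.op h x = ∑ γ ∈ S, b γ • ρ.π γ x := by
    rw [hS _ _ ρ, sum_apply]
    rfl
  rw [← hop]
  exact (ρ.ext a - ρ.op h).le_of_opNorm_le hclose x

/-- If `Γ` has a Kazhdan projection for a nonnegative weight, a vector of `L²` which is almost
invariant under a suitable finite subset of `Γ` is close to a `Γ`-invariant vector. -/
theorem exists_finset_forall_exists_invariant {G : Type u} [Group G] [TopologicalSpace G]
    [IsTopologicalGroup G] [MeasurableSpace G] [BorelSpace G] {Y : Type v} [MulAction G Y]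
    [MeasurableSpace Y] [MeasurableConstSMul G Y] [TopologicalSpace Y] [R1Space Y] [BorelSpace Y]
    [ContinuousSMul G Y] (ν : Measure Y) [SMulInvariantMeasure G Y ν] [IsProbabilityMeasure ν]
    [ν.Regular] {Γ : Subgroup G} [DiscreteTopology Γ] {w : Weight Γ} (hw : ∀ γ, 0 ≤ w.toFun γ)
    (hΓ : HasKazhdanProjection hilbertClass.{v} w) :
    ∃ (S : Finset Γ) (δ : ℝ), 0 < δ ∧ ∀ f : Lp ℂ 2 ν,
      (∀ γ ∈ S, ‖koopman ν (γ : G) f - f‖ ≤ δ * ‖f‖) →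
      ∃ η : Lp ℂ 2 ν, (∀ γ : Γ, koopman ν (γ : G) η = η) ∧ ‖η - f‖ ≤ 3 / 8 * ‖f‖ := by
  obtain ⟨P, -, hP⟩ := hΓ
  obtain ⟨S, b, hSb⟩ := exists_norm_ext_sub_sum_le P (ε := 1 / 8) (by norm_num)
  obtain ⟨T, hTinv, hTfix, hclose⟩ : ∃ T : Lp ℂ 2 ν → Lp ℂ 2 ν,
      (∀ (f : Lp ℂ 2 ν) (γ : Γ), koopman ν (γ : G) (T f) = T f) ∧
      (∀ f : Lp ℂ 2 ν, (∀ γ : Γ, koopman ν (γ : G) f = f) → T f = f) ∧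
      ∀ f : Lp ℂ 2 ν, ‖T f - ∑ γ ∈ S, b γ • koopman ν (γ : G) f‖ ≤ 1 / 8 * ‖f‖ :=
    let ρ : BoundedRep Γ hilbertClass.{v} w :=
      koopmanRep ν Γ.subtype continuous_subtype_val w hw
    ⟨ρ.ext P, (hP ρ).map_mem, (hP ρ).map_id, hSb ρ⟩
  -- the coefficients sum almost to one, as seen on the constant function one
  have hb : ‖∑ γ ∈ S, b γ - 1‖ ≤ 1 / 8 := by
    set one : Lp ℂ 2 ν := indicatorConstLp 2 MeasurableSet.univ (measure_ne_top ν _) 1 with hone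
    have hnorm : ‖one‖ = 1 := by
      rw [hone, norm_indicatorConstLp (by simp) (by simp)]
      simp
    have hinv : ∀ g : G, koopman ν g one = one := fun g => by
      rw [hone, koopman_indicatorConstLp]
      rfl
    have h1 : T one = one := hTfix one fun γ => hinv γ
    have h2 := hclose one
    simp only [h1, hinv, ← Finset.sum_smul, hnorm, mul_one] at h2
    rw [norm_sub_rev] at h2
    have h3 : (∑ γ ∈ S, b γ) • one - one = (∑ γ ∈ S, b γ - 1) • one := by rw [sub_smul, one_smul]
    rwa [h3, norm_smul, hnorm, mul_one] at h2
  set β : ℝ := ∑ γ ∈ S, ‖b γ‖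
  have hβ : 0 ≤ β := Finset.sum_nonneg fun _ _ => norm_nonneg _
  refine ⟨S, 1 / (8 * (β + 1)), by positivity, fun f hf => ⟨T f, hTinv f, ?_⟩⟩
  have h1 : ‖∑ γ ∈ S, b γ • koopman ν (γ : G) f - (∑ γ ∈ S, b γ) • f‖ ≤ 1 / 8 * ‖f‖ := by
    rw [Finset.sum_smul, ← Finset.sum_sub_distrib]
    calc ‖∑ γ ∈ S, (b γ • koopman ν (γ : G) f - b γ • f)‖
        ≤ ∑ γ ∈ S, ‖b γ‖ * (1 / (8 * (β + 1)) * ‖f‖) := by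
          refine norm_sum_le_of_le _ fun γ hγ => ?_
          rw [← smul_sub, norm_smul]
          exact mul_le_mul_of_nonneg_left (hf γ hγ) (norm_nonneg _)
      _ = β / (β + 1) * (1 / 8 * ‖f‖) := by
          rw [← Finset.sum_mul]
          field_simp
          rfl
      _ ≤ 1 / 8 * ‖f‖ := mul_le_of_le_one_left (by positivity)
          ((div_le_one (by positivity)).2 (by linarith))
  have h2 : ‖(∑ γ ∈ S, b γ) • f - f‖ ≤ 1 / 8 * ‖f‖ := by
    have h3 : (∑ γ ∈ S, b γ) • f - f = (∑ γ ∈ S, b γ - 1) • f := by rw [sub_smul, one_smul]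
    rw [h3, norm_smul]
    exact mul_le_mul_of_nonneg_right hb (norm_nonneg _)
  have h3 := norm_sub_le_norm_sub_add_norm_sub (T f)
    (∑ γ ∈ S, b γ • koopman ν (γ : G) f) f
  have h4 := norm_sub_le_norm_sub_add_norm_sub (∑ γ ∈ S, b γ • koopman ν (γ : G) f)
    ((∑ γ ∈ S, b γ) • f) f
  linarith [hclose f]

/-- For a bounded equivariant map `Φ` from `G/Γ` to `L²`, the average of `Φ` is a `G`-invariant
vector, so a vector `f` orthogonal to the invariant vectors is orthogonal to it. The average is
defined weakly, which avoids any separability assumption. -/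
theorem integral_inner_orbit_eq_zero {G : Type u} [Group G] [TopologicalSpace G]
    [IsTopologicalGroup G] {Γ : Subgroup G} [MeasurableSpace (G ⧸ Γ)] [BorelSpace (G ⧸ Γ)]
    (ν : Measure (G ⧸ Γ)) [IsProbabilityMeasure ν] [SMulInvariantMeasure G (G ⧸ Γ) ν]
    {Φ : G ⧸ Γ → Lp ℂ 2 ν} (hΦ : Continuous Φ) {C : ℝ}
    (hC : ∀ x, ‖Φ x‖ ≤ C) (hsmul : ∀ (h : G) (x : G ⧸ Γ), Φ (h • x) = koopman ν h (Φ x))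
    {f : Lp ℂ 2 ν} (hf : ∀ h : Lp ℂ 2 ν, (∀ g : G, koopman ν g h = h) → inner ℂ h f = 0) :
    ∫ x, inner ℂ (Φ x) f ∂ν = 0 := by
  have hb : ∀ (ψ : Lp ℂ 2 ν) (x : G ⧸ Γ), ‖inner ℂ (Φ x) ψ‖ ≤ C * ‖ψ‖ := fun ψ x =>
    (norm_inner_le_norm _ _).trans (mul_le_mul_of_nonneg_right (hC x) (norm_nonneg _))
  have hint : ∀ ψ : Lp ℂ 2 ν, Integrable (fun x => inner ℂ (Φ x) ψ) ν := fun ψ =>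
    Integrable.of_bound (hΦ.inner continuous_const).aestronglyMeasurable (C * ‖ψ‖)
      (Eventually.of_forall (hb ψ))
  -- the invariant vector is the one representing this functional
  let L : Lp ℂ 2 ν →L[ℂ] ℂ := LinearMap.mkContinuous
    { toFun := fun ψ => ∫ x, inner ℂ (Φ x) ψ ∂ν
      map_add' := fun ψ ψ' => by
        simp only [inner_add_right]
        exact integral_add (hint ψ) (hint ψ')
      map_smul' := fun a ψ => by
        simp only [inner_smul_right, RingHom.id_apply, smul_eq_mul]
        exact integral_const_mul _ _ } C fun ψ => by
    simpa using norm_integral_le_of_norm_le_const (μ := ν) (Eventually.of_forall (hb ψ))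
  have hL : ∀ ψ, inner ℂ ((InnerProductSpace.toDual ℂ (Lp ℂ 2 ν)).symm L) ψ =
      ∫ x, inner ℂ (Φ x) ψ ∂ν := fun ψ => InnerProductSpace.toDual_symm_apply
  rw [← hL]
  refine hf _ fun h => ext_inner_right ℂ fun ψ => ?_
  have h1 : ∀ a b : Lp ℂ 2 ν, inner ℂ (koopman ν h a) b = inner ℂ a (koopman ν h⁻¹ b) := by
    intro a b
    rw [← (koopman ν h⁻¹).inner_map_map, koopman_inv_koopman]
  rw [h1, hL, hL, ← integral_smul_eq_self (fun x => inner ℂ (Φ x) ψ) (g := h)]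
  refine integral_congr_ae (Eventually.of_forall fun x => ?_)
  simp only [hsmul, h1]

section Gap

variable {G : Type u} [Group G] [TopologicalSpace G] [IsTopologicalGroup G] [T2Space G]
  [LocallyCompactSpace G] [MeasurableSpace G] [BorelSpace G]
  {Γ : Subgroup G} [DiscreteTopology Γ] [MeasurableSpace (G ⧸ Γ)] [BorelSpace (G ⧸ Γ)]
  (ν : Measure (G ⧸ Γ)) [ν.Regular] [SMulInvariantMeasure G (G ⧸ Γ) ν]

/-- The orbit map `gΓ ↦ π(g) η` of a `Γ`-invariant vector of the Koopman representation. -/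
theorem exists_continuous_koopman_orbit [IsFiniteMeasure ν] {η : Lp ℂ 2 ν}
    (hη : ∀ γ : Γ, koopman ν (γ : G) η = η) :
    ∃ Φ : G ⧸ Γ → Lp ℂ 2 ν, Continuous Φ ∧ (∀ g : G, Φ (g : G ⧸ Γ) = koopman ν g η) ∧
      ∀ (h : G) (x : G ⧸ Γ), Φ (h • x) = koopman ν h (Φ x) :=
  let ρ : BoundedRep G hilbertClass.{u} ⟨fun _ => 0, fun _ _ => ⟨0, by simp [upperBounds]⟩⟩ :=
    koopmanRep ν (MonoidHom.id G) continuous_id _ fun _ => le_rfl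
  ⟨ρ.orbitMap (η := η) hη, ρ.continuous_orbitMap (η := η) hη, fun _ => rfl,
    fun h x => ρ.orbitMap_smul (η := η) hη h x⟩

/-- If `Γ` has a Kazhdan projection for a nonnegative weight and the class of Hilbert spaces, then
`G/Γ` has spectral gap: an almost invariant vector of `L²` is close to a `Γ`-invariant one, whose
average over `G/Γ` is `G`-invariant and not orthogonal to the given vector. -/
theorem hasSpectralGap_of_hasKazhdanProjection [IsProbabilityMeasure ν] {w : Weight Γ}
    (hw : ∀ γ, 0 ≤ w.toFun γ)
    (hΓ : HasKazhdanProjection hilbertClass.{u} w) : HasSpectralGap G ν := by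
  obtain ⟨S, δ, hδ, hS⟩ := exists_finset_forall_exists_invariant ν hw hΓ
  obtain ⟨B, -, hB, hνB⟩ := (isOpen_univ (X := G ⧸ Γ)).exists_lt_isCompact (μ := ν)
    (r := ENNReal.ofReal (9 / 10)) (by simp; norm_num)
  have hνB' : 9 / 10 ≤ ν.real B := (ENNReal.ofReal_le_iff_le_toReal (measure_ne_top _ _)).1 hνB.le
  obtain ⟨K, hK, hBK⟩ := exists_isCompact_subset_image_mk Γ hB
  refine ⟨insert 1 (K ∪ ((↑) : Γ → G) '' S), min δ (1 / 16),
    (hK.union (S.finite_toSet.image _).isCompact).insert 1, lt_min hδ (by norm_num),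
    fun f hf => ?_⟩
  by_contra! hcon
  have hN : 0 < ‖f‖ := by
    have h1 := (norm_nonneg _).trans_lt (hcon 1 (mem_insert _ _))
    exact (pos_iff_pos_of_mul_pos h1).1 (lt_min hδ (by norm_num))
  obtain ⟨η, hη, hηf⟩ := hS f fun γ hγ =>
    (hcon γ (Or.inr (Or.inr ⟨γ, hγ, rfl⟩))).le.trans
      (mul_le_mul_of_nonneg_right (min_le_left _ _) (norm_nonneg _))
  obtain ⟨Φ, hΦ, hΦmk, hΦsmul⟩ := exists_continuous_koopman_orbit ν hη
  have hη2 : ‖η‖ ≤ 11 / 8 * ‖f‖ := by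
    have := norm_le_norm_add_norm_sub' η f
    linarith
  have hΦn : ∀ x, ‖Φ x‖ ≤ 11 / 8 * ‖f‖ := by
    intro x
    obtain ⟨g, rfl⟩ := QuotientGroup.mk_surjective x
    rw [hΦmk, (koopman ν g).norm_map]
    exact hη2
  have hre : ∀ a b : Lp ℂ 2 ν, -(‖a‖ * ‖b‖) ≤ (inner ℂ a b).re := fun a b =>
    (abs_le.1 ((Complex.abs_re_le_norm _).trans (norm_inner_le_norm a b))).1
  have hηre : 5 / 8 * ‖f‖ ^ 2 ≤ (inner ℂ η f).re := by
    have h1 : inner ℂ η f = inner ℂ f f + inner ℂ (η - f) f := by rw [← inner_add_left]; simp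
    have h2 : (inner ℂ f f).re = ‖f‖ ^ 2 := (norm_sq_eq_re_inner (𝕜 := ℂ) f).symm
    have h3 := mul_le_mul_of_nonneg_right hηf hN.le
    rw [h1, Complex.add_re, h2]
    linarith [hre (η - f) f]
  -- over the large set `B` the vectors `Φ x` have a definite component along `f`
  have hlow : ∀ x, -(11 / 8 * ‖f‖ ^ 2) + B.indicator (fun _ => 15 / 8 * ‖f‖ ^ 2) x ≤
      (inner ℂ (Φ x) f).re := by
    intro x
    by_cases hx : x ∈ B
    · obtain ⟨g, hg, rfl⟩ := hBK hx
      rw [indicator_of_mem hx, hΦmk]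
      have h1 : inner ℂ (koopman ν g η) f =
          inner ℂ η f + inner ℂ (koopman ν g η) (f - koopman ν g f) := by
        rw [inner_sub_right, (koopman ν g).inner_map_map]
        ring
      have h2 : ‖f - koopman ν g f‖ ≤ 1 / 16 * ‖f‖ := by
        rw [norm_sub_rev]
        exact (hcon g (Or.inr (Or.inl hg))).le.trans
          (mul_le_mul_of_nonneg_right (min_le_right _ _) hN.le)
      have h3 := mul_le_mul hη2 h2 (norm_nonneg _) (by positivity)
      have h4 := hre (koopman ν g η) (f - koopman ν g f)
      rw [(koopman ν g).norm_map] at h4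
      rw [h1, Complex.add_re]
      nlinarith
    · rw [indicator_of_notMem hx, add_zero]
      have h3 := mul_le_mul_of_nonneg_right (hΦn x) hN.le
      linarith [hre (Φ x) f]
  have hinte : Integrable (fun x => inner ℂ (Φ x) f) ν :=
    Integrable.of_bound (hΦ.inner continuous_const).aestronglyMeasurable (11 / 8 * ‖f‖ * ‖f‖)
      (Eventually.of_forall fun x => (norm_inner_le_norm _ _).trans
        (mul_le_mul_of_nonneg_right (hΦn x) hN.le))
  have hzero : ∫ x, (inner ℂ (Φ x) f).re ∂ν = 0 := by
    have h1 := integral_re hinte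
    rw [integral_inner_orbit_eq_zero ν hΦ hΦn hΦsmul hf] at h1
    simpa using h1
  have hind : Integrable (B.indicator fun _ => 15 / 8 * ‖f‖ ^ 2) ν :=
    (integrable_const _).indicator hB.measurableSet
  have hmono := integral_mono ((integrable_const (-(11 / 8 * ‖f‖ ^ 2))).add hind) hinte.re hlow
  have hcomp : ∫ x, (-(11 / 8 * ‖f‖ ^ 2) + B.indicator (fun _ => 15 / 8 * ‖f‖ ^ 2) x) ∂ν =
      -(11 / 8 * ‖f‖ ^ 2) + ν.real B * (15 / 8 * ‖f‖ ^ 2) := by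
    rw [integral_add (integrable_const _) hind, integral_indicator_const _ hB.measurableSet]
    simp
  have hmono' : -(11 / 8 * ‖f‖ ^ 2) + ν.real B * (15 / 8 * ‖f‖ ^ 2) ≤ 0 := by
    rw [← hcomp, ← hzero]
    exact hmono
  have h1 := mul_le_mul_of_nonneg_right hνB' (show 0 ≤ 15 / 8 * ‖f‖ ^ 2 by positivity)
  nlinarith [pow_pos hN 2]

end Gap

/-- A representation bounded by `exp w` vanishes if `w` is negative at `g` and `g⁻¹`, since then
both `π(g)` and its inverse are strict contractions. -/
theorem BoundedRep.eq_zero_of_neg {G : Type u} [Group G] [TopologicalSpace G] {E : BanachClass.{v}}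
    {w : Weight G} (ρ : BoundedRep G E w) {g : G} (hg : w.toFun g < 0) (hg' : w.toFun g⁻¹ < 0)
    (x : ρ.X) : x = 0 := by
  have hle : ∀ {h : G}, w.toFun h < 0 → ∀ y, ‖ρ.π h y‖ ≤ Real.exp (w.toFun h) * ‖y‖ := fun _ y =>
    (ρ.π _).le_of_opNorm_le (ρ.norm_le _) y
  by_contra hx
  have h1 : ρ.π g⁻¹ (ρ.π g x) = x := by
    rw [← mul_apply_eq_comp, ← map_mul, inv_mul_cancel, map_one, one_apply_eq_self]
  have h2 := (hle hg' (ρ.π g x)).trans (mul_le_mul_of_nonneg_left (hle hg x) (Real.exp_pos _).le)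
  rw [h1, ← mul_assoc, ← Real.exp_add] at h2
  exact absurd h2 (not_le.2 (mul_lt_of_lt_one_left (norm_pos_iff.2 hx)
    ((Real.exp_lt_exp.2 (by linarith)).trans_eq Real.exp_zero)))

/-- If the weight is negative somewhere, all representations vanish and zero is a Kazhdan
projection. -/
theorem hasKazhdanProjection_of_neg {G : Type u} [Group G] [TopologicalSpace G]
    [IsTopologicalGroup G] [LocallyCompactSpace G] [MeasurableSpace G] [BorelSpace G]
    {E : BanachClass.{v}} {ℓ : LengthFunction G} {s c : ℝ} {g : G} (hg : s * ℓ.toFun g + c < 0) :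
    HasKazhdanProjection E (ℓ.weight s c) := by
  have h0 : ∀ (ρ : BoundedRep G E (ℓ.weight s c)) (x : ρ.X), x = 0 := fun ρ =>
    ρ.eq_zero_of_neg hg (by rw [← ℓ.inv g] at hg; exact hg)
  refine ⟨0, IsIdempotentElem.zero, fun ρ => ⟨fun x => ?_, fun x _ => ?_⟩⟩
  · rw [h0 ρ (ρ.ext 0 x)]
    exact zero_mem _
  · rw [h0 ρ x, map_zero]

end StrongT

end

theorem mainTheorem8 {G : Type u} [Group G] [TopologicalSpace G] [IsTopologicalGroup G]
    [LocallyCompactSpace G] [T2Space G] [MeasurableSpace G] [BorelSpace G]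
    (Γ : Subgroup G) [DiscreteTopology Γ]
    [MeasurableSpace (G ⧸ Γ)] [BorelSpace (G ⧸ Γ)]
    (ν : Measure (G ⧸ Γ)) [IsProbabilityMeasure ν] [ν.Regular] [SMulInvariantMeasure G (G ⧸ Γ) ν]
    (ℓ : StrongT.LengthFunction G) :
    ∃ s₀ : ℝ, 0 < s₀ ∧
      (∀ s c : ℝ, s ≤ s₀ → 0 ≤ c →
        StrongT.HasKazhdanProjection StrongT.hilbertClass.{u} ((ℓ.restrict Γ).weight s c) →
        StrongT.HasKazhdanProjection StrongT.hilbertClass.{u} (ℓ.weight s c)) ∧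
      (StrongT.HasSpectralGap G ν →
        ∀ (E : StrongT.BanachClass.{v}) (s c : ℝ), s ≤ s₀ → 0 ≤ c →
          StrongT.HasKazhdanProjection E ((ℓ.restrict Γ).weight s c) →
          StrongT.HasKazhdanProjection E (ℓ.weight s c)) := by
  by_cases hgap : StrongT.HasSpectralGap G ν
  · obtain ⟨K, r, hK, hK1, hr0, hr1, hdecay⟩ := hgap.exists_exponential_decay
    obtain ⟨L, hL⟩ := ℓ.bddAbove K hK
    have hL' : ∀ g ∈ K, ℓ.toFun g ≤ L := fun g hg => hL ⟨g, hg, rfl⟩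
    -- for `s₀` small, the growth of `exp (s₀ ℓ)` does not offset the decay of the measure
    have hlim : Filter.Tendsto (fun t : ℝ => Real.exp (t * L) * r) (nhds 0) (nhds r) :=
      Continuous.tendsto' (by fun_prop) _ _ (by simp)
    obtain ⟨s₀, hs₀, hpos⟩ := (((hlim.eventually_lt_const hr1).filter_mono
      nhdsWithin_le_nhds).and (self_mem_nhdsWithin (s := Ioi (0 : ℝ)))).exists
    exact ⟨s₀, hpos,
      fun s c hs _ => StrongT.hasKazhdanProjection_of_exponential_decay hK hK1 hr0 hdecay hL'
        (le_of_lt hpos) hs₀ hs,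
      fun _ E s c hs _ => StrongT.hasKazhdanProjection_of_exponential_decay hK hK1 hr0 hdecay hL'
        (le_of_lt hpos) hs₀ hs⟩
  · refine ⟨1, one_pos, fun s c _ _ hΓ => ?_, fun h => absurd h hgap⟩
    by_cases hw : ∀ γ : Γ, 0 ≤ s * ℓ.toFun γ + c
    · exact absurd (StrongT.hasSpectralGap_of_hasKazhdanProjection ν hw hΓ) hgap
    · push Not at hw
      obtain ⟨γ, hγ⟩ := hw
      exact StrongT.hasKazhdanProjection_of_neg hγ
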